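/- Over $\mathsf{RCA}_0$, the principle $\mathsf{CD}\text{-}\mathsf{PB}$ implies the principle $\mathsf{L_{\omega_1,\omega}}\text{-}\mathsf{CA}$. That is, every model of $\mathsf{RCA}_0$ (with an arbitrary, possibly nonstandard, first-order part) that satisfies $\mathsf{CD}\text{-}\mathsf{PB}$ also satisfies $\mathsf{L_{\omega_1,\omega}}\text{-}\mathsf{CA}$. The two principles are the following statements of second order arithmetic. **$\mathsf{CD}\text{-}\mathsf{PB}$: every completely determined Borel set has the property of Baire.** A *labeled Borel code* is a well-founded tree $T\subseteq\omega^{<\omega}$ with a labelling function $\ell$ on $T$, where interior nodes are labeled $\cup$ or $\cap$ and each leaf is labeled by a code of a clopen subset of $2^\omega$ (a number that codes a finite set $F\subseteq 2^{<\omega}$, representing $\bigcup_{p\in F}[p]$). An *evaluation map* for $X\in 2^\omega$ in $T$ is a function $f:T\to\{0,1\}$ such that for a leaf $\sigma$, $f(\sigma)=1$ iff $X$ is in the clopen set coded by $\ell(\sigma)$; for a union node $\sigma$, $f(\sigma)=1$ iff $f(\sigma^\smallfrown n)=1$ for some child $\sigma^\smallfrown n\in T$; for an intersection node $\sigma$,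 $f(\sigma)=1$ iff $f(\sigma^\smallfrown n)=1$ for all children $\sigma^\smallfrown n\in T$. Write $X\in|T|$ if there is an evaluation map $f$ for $X$ in $T$ with $f(\lambda)=1$, where $\lambda$ is the root, and let $T^c$ be the code obtained from $T$ by exchanging the labels $\cup$ and $\cap$ and replacing each leaf label by a code of the complementary clopen set. The code $T$ is *completely determined* if every $X\in 2^\omega$ has an evaluation map in $T$. Open subsets of $2^\omega$ are coded by sets $U\subseteq 2^{<\omega}$, with $X\in U$ iff some $p\in U$ is an initial segment of $X$. The principle says: for every completely determined labeled Borel code $T$ there are open sets $U$, $V$ and a sequence $(D_n)_{n}$ of open sets such that $U\cap V=\emptyset$, the sets $U\cup V$ and all $D_n$ are dense in $2^\omega$, and for all $X\in\bigcap_n D_n$, $X\in U$ implies $X\in|T|$ and $X\in V$ implies $X\in|T^c|$. **$\mathsf{L_{\omega_1,\omega}}\text{-}\mathsf{CA}$.** A formula of $L_{\omega_1,\omega}$ (in the language whose only atomic formulas are $\mathtt{true}$ and $\mathtt{false}$) is a well-founded tree $T\subseteq\omega^{<\omega}$ with a labelling function, where interior nodes are labeled $\cup$ (countable disjunction) or $\cap$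 (countable conjunction) and leaves are labeled $\mathtt{true}$ or $\mathtt{false}$. An evaluation map for it is a function $f:T\to\{0,1\}$ that takes the value $1$ at leaves labeled $\mathtt{true}$ and $0$ at leaves labeled $\mathtt{false}$, and satisfies the conditions above at the interior nodes. The formula is *completely determined* if it has an evaluation map, and *true* if it has an evaluation map with value $1$ at the root. The principle says: for every sequence $(\phi_i)_{i\in\mathbb N}$ of completely determined formulas of $L_{\omega_1,\omega}$, the set $\{i:\phi_i\text{ is true}\}$ exists. -/

import Mathlib

namespace ReverseMath

universe u

/-! ### Second order arithmetic and the system RCA₀ -/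

/-- A structure for the language of second order arithmetic: a first order part `Num` with
`0, 1, +, ·, <`, possibly nonstandard, and a nonempty collection `Sets` of subsets of `Num`, over
which the set variables range. -/
structure L2Structure where
  Num : Type u
  [zero : Zero Num]
  [one : One Num]
  [add : Add Num]
  [mul : Mul Num]
  [lt : LT Num]
  Sets : Set (Set Num)
  sets_nonempty : Sets.Nonempty

attribute [instance] L2Structure.zero L2Structure.one L2Structure.add L2Structure.mul
  L2Structure.lt

/-- Numerical terms; the number variables are indexed by `ℕ`. -/
inductive NumTerm : Type
  | var (i : ℕ)
  | zero
  | one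
  | add (s t : NumTerm)
  | mul (s t : NumTerm)

/-- Bounded quantifier (that is, `Σ⁰₀`) formulas of second order arithmetic, with free set
variables indexed by `ℕ`. Number variables are de Bruijn indices: the bounded quantifiers
`ball t φ` (for all `x < t`) and `bex t φ` (for some `x < t`) bind the variable `0` of `φ`, while
the bound `t` is read outside the quantifier. -/
inductive BddFormula : Type
  | eq (s t : NumTerm)
  | lt (s t : NumTerm)
  | mem (t : NumTerm) (i : ℕ)
  | neg (φ : BddFormula)
  | and (φ ψ : BddFormula)
  | or (φ ψ : BddFormula)
  | ball (t : NumTerm) (φ : BddFormula)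
  | bex (t : NumTerm) (φ : BddFormula)

/-- The assignment `a, v 0, v 1, …`. -/
def consVal {α : Type u} (a : α) (v : ℕ → α) : ℕ → α
  | 0 => a
  | i + 1 => v i

def NumTerm.eval (M : L2Structure.{u}) (v : ℕ → M.Num) : NumTerm → M.Num
  | .var i => v i
  | .zero => 0
  | .one => 1
  | .add s t => s.eval M v + t.eval M v
  | .mul s t => s.eval M v * t.eval M v

/-- Truth in `M` of a bounded quantifier formula, under the assignments `v` and `W` of the number
and set variables. -/
def BddFormula.Holds (M : L2Structure.{u}) (W : ℕ → Set M.Num) : BddFormula → (ℕ → M.Num) → Prop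
  | .eq s t, v => s.eval M v = t.eval M v
  | .lt s t, v => s.eval M v < t.eval M v
  | .mem t i, v => t.eval M v ∈ W i
  | .neg φ, v => ¬ φ.Holds M W v
  | .and φ ψ, v => φ.Holds M W v ∧ ψ.Holds M W v
  | .or φ ψ, v => φ.Holds M W v ∨ ψ.Holds M W v
  | .ball t φ, v => ∀ x : M.Num, x < t.eval M v → φ.Holds M W (consVal x v)
  | .bex t φ, v => ∃ x : M.Num, x < t.eval M v ∧ φ.Holds M W (consVal x v)

/-- The property of `n` defined in `M` by the `Σ⁰₁` formula `∃ m, θ(m, n, v, W)`. -/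
def Sigma01 (M : L2Structure.{u}) (θ : BddFormula) (v : ℕ → M.Num) (W : ℕ → Set M.Num)
    (n : M.Num) : Prop :=
  ∃ m : M.Num, θ.Holds M W (consVal m (consVal n v))

/-- The property of `n` defined in `M` by the `Π⁰₁` formula `∀ m, θ(m, n, v, W)`. -/
def Pi01 (M : L2Structure.{u}) (θ : BddFormula) (v : ℕ → M.Num) (W : ℕ → Set M.Num)
    (n : M.Num) : Prop :=
  ∀ m : M.Num, θ.Holds M W (consVal m (consVal n v))

/-- `M` is a model of `RCA₀`: the basic axioms of arithmetic, the `Σ⁰₁` induction scheme and the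
`Δ⁰₁` comprehension scheme, the schemes with number parameters and with set parameters from
`M`. -/
structure IsModelRCA0 (M : L2Structure.{u}) : Prop where
  succ_ne_zero : ∀ n : M.Num, n + 1 ≠ 0
  succ_inj : ∀ m n : M.Num, m + 1 = n + 1 → m = n
  add_zero : ∀ m : M.Num, m + 0 = m
  add_succ : ∀ m n : M.Num, m + (n + 1) = (m + n) + 1
  mul_zero : ∀ m : M.Num, m * 0 = 0
  mul_succ : ∀ m n : M.Num, m * (n + 1) = m * n + m
  not_lt_zero : ∀ m : M.Num, ¬ m < 0
  lt_succ_iff : ∀ m n : M.Num, m < n + 1 ↔ m < n ∨ m = n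
  sigma01_induction : ∀ (θ : BddFormula) (v : ℕ → M.Num) (W : ℕ → Set M.Num),
    (∀ i, W i ∈ M.Sets) →
    Sigma01 M θ v W 0 →
    (∀ n, Sigma01 M θ v W n → Sigma01 M θ v W (n + 1)) →
    ∀ n, Sigma01 M θ v W n
  delta01_comprehension : ∀ (θ ψ : BddFormula) (v : ℕ → M.Num) (W : ℕ → Set M.Num),
    (∀ i, W i ∈ M.Sets) →
    (∀ n, Sigma01 M θ v W n ↔ Pi01 M ψ v W n) →
    {n | Sigma01 M θ v W n} ∈ M.Sets

/-! ### Coding inside a structure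

In all that follows the quantifiers range over the numbers of `M` and over the sets in `M.Sets`
only, so that every notion is the interpretation in `M` of a formula of second order arithmetic. -/

section Coding

variable (M : L2Structure.{u})

open Classical in
/-- The code `⟨a, b⟩` of a pair, by the canonical bijection (the one of `Nat.pair`). -/
noncomputable def pair (a b : M.Num) : M.Num :=
  if a < b then b * b + a else a * a + a + b

/-- The `i`-th set of the sequence of sets that is coded by `Z`. -/
def sec (Z : Set M.Num) (i : M.Num) : Set M.Num := {x | pair M i x ∈ Z}

/-- `g` is (the graph of) a function from numbers to numbers. -/
def IsFun (g : Set M.Num) : Prop := ∀ n : M.Num, ∃! y : M.Num, pair M n y ∈ g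

/-- The extension `σ⌢n` of a string of numbers. Every number is the code of exactly one finite
string: `0` codes the empty string and `⟨σ, n⟩ + 1` codes `σ⌢n`. -/
noncomputable def snoc (σ n : M.Num) : M.Num := pair M σ n + 1

/-- The extension `p⌢0` of a binary string. Every number is the code of exactly one binary string,
in length-lexicographic order: `0` codes the empty string, `2p + 1` codes `p⌢0` and `2p + 2`
codes `p⌢1`. -/
def snocZero (p : M.Num) : M.Num := p + p + 1

/-- The extension `p⌢1` of a binary string. -/
def snocOne (p : M.Num) : M.Num := p + p + 1 + 1

/-- `g` is the function that takes `n` to the binary string `X(0) X(1) ⋯ X(n - 1)`. Elements `X` of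
`2^ω` are given by sets, where `X(n) = 1` if and only if `n ∈ X`. -/
def IsRestriction (X g : Set M.Num) : Prop :=
  IsFun M g ∧ pair M 0 0 ∈ g ∧
    ∀ n p : M.Num, pair M n p ∈ g →
      (n ∈ X → pair M (n + 1) (snocOne M p) ∈ g) ∧
      (n ∉ X → pair M (n + 1) (snocZero M p) ∈ g)

/-- `p ≺ X`: the binary string `p` is an initial segment of `X`. -/
def Prefix (p : M.Num) (X : Set M.Num) : Prop :=
  ∃ g ∈ M.Sets, IsRestriction M X g ∧ ∃ n : M.Num, pair M n p ∈ g

/-- `X` lies in the open subset of `2^ω` that is coded by the set `U` of binary strings. -/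
def InOpen (U X : Set M.Num) : Prop := ∃ p ∈ U, Prefix M p X

/-- `i` lies in the finite set that is coded by the number `c`, which is
`{i < k : (i + 1) m + 1 divides n}` if `c` is `⟨⟨k, m⟩, n⟩`. -/
def InFinite (c i : M.Num) : Prop :=
  ∃ k m n : M.Num, c = pair M (pair M k m) n ∧ i < k ∧ ∃ d : M.Num, n = ((i + 1) * m + 1) * d

/-- `X` lies in the clopen subset of `2^ω` given by the finite set of binary strings with
code `c`. -/
def InClopen (c : M.Num) (X : Set M.Num) : Prop := ∃ p : M.Num, InFinite M c p ∧ Prefix M p X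

/-! ### Well-founded labeled trees -/

/-- `T` is a tree of strings of numbers. -/
def IsTree (T : Set M.Num) : Prop :=
  0 ∈ T ∧ ∀ σ n : M.Num, snoc M σ n ∈ T → σ ∈ T

/-- In `M` there is no infinite path through `T`; a path is given by the sequence `g` of its finite
initial segments. -/
def IsWellFounded (T : Set M.Num) : Prop :=
  ¬ ∃ g ∈ M.Sets, IsFun M g ∧ pair M 0 0 ∈ g ∧
    (∀ n σ : M.Num, pair M n σ ∈ g → ∃ k : M.Num, pair M (n + 1) (snoc M σ k) ∈ g) ∧
    ∀ n σ : M.Num, pair M n σ ∈ g → σ ∈ T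

def IsLeaf (T : Set M.Num) (σ : M.Num) : Prop := σ ∈ T ∧ ∀ n : M.Num, snoc M σ n ∉ T

def IsInterior (T : Set M.Num) (σ : M.Num) : Prop := σ ∈ T ∧ ∃ n : M.Num, snoc M σ n ∈ T

/-- The label `∪` (union, or disjunction). -/
def cupLabel : M.Num := 0

/-- The label `∩` (intersection, or conjunction). -/
def capLabel : M.Num := 1

/-- The label that stands for the clopen set with code `c`. -/
def clopenLabel (c : M.Num) : M.Num := c + 1 + 1

/-- The label `true` of a leaf of a formula. -/
def trueLabel : M.Num := 1 + 1

/-- The label `false` of a leaf of a formula. -/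
def falseLabel : M.Num := 1 + 1 + 1

/-- `L` is (the graph of) a function with domain `T`. -/
def IsLabelling (T L : Set M.Num) : Prop :=
  (∀ σ y : M.Num, pair M σ y ∈ L → σ ∈ T) ∧ ∀ σ ∈ T, ∃! y : M.Num, pair M σ y ∈ L

/-- `(T, L)` is a well-founded labeled tree, with labels `∪` or `∩` at the interior nodes and
labels with the property `leafLabel` at the leaves. -/
def IsLabeledTree (leafLabel : M.Num → Prop) (T L : Set M.Num) : Prop :=
  IsTree M T ∧ IsWellFounded M T ∧ IsLabelling M T L ∧
    (∀ σ y : M.Num, pair M σ y ∈ L → IsInterior M T σ → y = cupLabel M ∨ y = capLabel M) ∧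
    (∀ σ y : M.Num, pair M σ y ∈ L → IsLeaf M T σ → leafLabel y)

/-- `f` is an evaluation map on the labeled tree `(T, L)`, when `leafTrue` tells which leaf labels
are true. The map from `T` to `{0, 1}` is given by the set `f` of the nodes where its value
is `1`. -/
def IsEvaluation (leafTrue : M.Num → Prop) (T L f : Set M.Num) : Prop :=
  f ⊆ T ∧ ∀ σ y : M.Num, pair M σ y ∈ L →
    (IsLeaf M T σ → (σ ∈ f ↔ leafTrue y)) ∧
    (IsInterior M T σ → y = cupLabel M →
      (σ ∈ f ↔ ∃ n : M.Num, snoc M σ n ∈ T ∧ snoc M σ n ∈ f)) ∧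
    (IsInterior M T σ → y = capLabel M →
      (σ ∈ f ↔ ∀ n : M.Num, snoc M σ n ∈ T → snoc M σ n ∈ f))

/-! ### Borel codes and the property of Baire -/

/-- `(T, L)` is a labeled Borel code. -/
def IsBorelCode (T L : Set M.Num) : Prop :=
  IsLabeledTree M (fun y => ∃ c : M.Num, y = clopenLabel M c) T L

/-- `f` is an evaluation map for `X` in the labeled Borel code `(T, L)`. -/
def IsBorelEvaluation (X T L f : Set M.Num) : Prop :=
  IsEvaluation M (fun y => ∃ c : M.Num, y = clopenLabel M c ∧ InClopen M c X) T L f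

/-- `X ∈ |T|`: there is an evaluation map for `X` with value `1` at the root. -/
def InBorel (X T L : Set M.Num) : Prop :=
  ∃ f ∈ M.Sets, IsBorelEvaluation M X T L f ∧ 0 ∈ f

/-- `L'` is a labelling of `T` complementary to `L`: the labels `∪` and `∩` are swapped, and the
label of each leaf is replaced by a code of the complementary clopen set. -/
def IsComplementLabelling (T L L' : Set M.Num) : Prop :=
  IsLabelling M T L' ∧ ∀ σ y : M.Num, pair M σ y ∈ L →
    (y = cupLabel M → pair M σ (capLabel M) ∈ L') ∧
    (y = capLabel M → pair M σ (cupLabel M) ∈ L') ∧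
    ∀ c : M.Num, y = clopenLabel M c →
      ∃ c' : M.Num, pair M σ (clopenLabel M c') ∈ L' ∧
        ∀ X ∈ M.Sets, InClopen M c' X ↔ ¬ InClopen M c X

/-- `X ∈ |Tᶜ|`. -/
def InBorelCompl (X T L : Set M.Num) : Prop :=
  ∃ L' ∈ M.Sets, IsComplementLabelling M T L L' ∧ InBorel M X T L'

/-- The labeled Borel code `(T, L)` is completely determined. -/
def IsCompletelyDetermined (T L : Set M.Num) : Prop :=
  ∀ X ∈ M.Sets, ∃ f ∈ M.Sets, IsBorelEvaluation M X T L f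

/-- The subset of `2^ω` of the `X` with `P X` meets every basic open set `[p]`. -/
def IsDenseIn (P : Set M.Num → Prop) : Prop :=
  ∀ p : M.Num, ∃ X ∈ M.Sets, Prefix M p X ∧ P X

/-- The open sets `U`, `V` and the sequence `D` of open sets form a Baire code. -/
def IsBaireCode (U V D : Set M.Num) : Prop :=
  (¬ ∃ X ∈ M.Sets, InOpen M U X ∧ InOpen M V X) ∧
    IsDenseIn M (fun X => InOpen M U X ∨ InOpen M V X) ∧
    ∀ n : M.Num, IsDenseIn M (fun X => InOpen M (sec M D n) X)

/-- `(U, V, D)` is a Baire approximation to the labeled Borel code `(T, L)`. -/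
def IsBaireApproximation (T L U V D : Set M.Num) : Prop :=
  IsBaireCode M U V D ∧
    ∀ X ∈ M.Sets, (∀ n : M.Num, InOpen M (sec M D n) X) →
      (InOpen M U X → InBorel M X T L) ∧ (InOpen M V X → InBorelCompl M X T L)

/-- `M` satisfies `CD-PB`: every completely determined Borel set has the property of Baire. -/
def SatisfiesCDPB : Prop :=
  ∀ T ∈ M.Sets, ∀ L ∈ M.Sets, IsBorelCode M T L → IsCompletelyDetermined M T L →
    ∃ U ∈ M.Sets, ∃ V ∈ M.Sets, ∃ D ∈ M.Sets, IsBaireApproximation M T L U V D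

/-! ### Formulas of `L_{ω₁,ω}` -/

/-- `(T, L)` is a formula of `L_{ω₁,ω}` in the language whose only atomic formulas are `true` and
`false`. -/
def IsFormula (T L : Set M.Num) : Prop :=
  IsLabeledTree M (fun y => y = trueLabel M ∨ y = falseLabel M) T L

/-- `f` is an evaluation map for the formula `(T, L)`. -/
def IsFormulaEvaluation (T L f : Set M.Num) : Prop :=
  IsEvaluation M (fun y => y = trueLabel M) T L f

/-- The formula `(T, L)` is completely determined. -/
def IsDeterminedFormula (T L : Set M.Num) : Prop := ∃ f ∈ M.Sets, IsFormulaEvaluation M T L f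

/-- The formula `(T, L)` is true. -/
def IsTrueFormula (T L : Set M.Num) : Prop :=
  ∃ f ∈ M.Sets, IsFormulaEvaluation M T L f ∧ 0 ∈ f

/-- `M` satisfies `L_{ω₁,ω}-CA`: for every sequence of completely determined formulas of
`L_{ω₁,ω}`, the set of the indices of those that are true exists. -/
def SatisfiesLCA : Prop :=
  ∀ T ∈ M.Sets, ∀ L ∈ M.Sets,
    (∀ i : M.Num, IsFormula M (sec M T i) (sec M L i) ∧
      IsDeterminedFormula M (sec M T i) (sec M L i)) →
    {i : M.Num | IsTrueFormula M (sec M T i) (sec M L i)} ∈ M.Sets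

end Coding

end ReverseMath

/-!
Let `φ i` be completely determined formulas, and let `m i` be the binary string `0ⁱ1`; these strings
are pairwise incompatible. The trees of all `φ i` are put above one root with the label `∪`, and the
leaves of `φ i` get the clopen set `[m i]` in place of `true` and the empty set in place of `false`
(`joinTree`, `joinLabelling`, `IsLeafTranslation`). The result is a Borel code for the union of the
`[m i]` with `φ i` true. It is completely determined (`isCompletelyDetermined_join`): for `X` in `[m
i]`, an evaluation map of `φ i`, extended by `0` on the other trees, is an evaluation map; for `X`
outside all `[m i]` the constant map `0` is one.

Let `U`, `V`, `D` be a Baire approximation to this code. Since `U ∪ V` is dense, some string in `U`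
or in `V` is compatible with `m i`. If `q ∈ U` is compatible with `m i`, then by the Baire category
theorem (`exists_generic`) there is a generic `X` above both, so that `X` lies in the coded set;
since the values of evaluation maps at the root of a well-founded tree are unique
(`IsEvaluation.root_mem_iff`), `φ i` is true. In the same way `q ∈ V` shows that `φ i` is not true.
So `φ i` is true if and only if some string in `U` is compatible with `m i`, if and only if no
string in `V` is (`isTrueFormula_iff`), and the set of these `i` exists by `Δ⁰₁` comprehension.

All of this takes place in a model of `RCA₀` whose numbers may be nonstandard, so that arithmetic
and recursion are first developed from the axioms. The numbers form a linearly ordered commutative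
semiring, by induction for formulas that are written by instance resolution (`BddDef`). On top of
the pairing function, `DeltaPred` and `DeltaFun` are the predicates and functions that exist in the
model; their closure properties are instances, too. Finite sets have codes by a version of Gödel's
`β` function (`exists_finite_code`), which yields definition by recursion (`exists_recursion`).
-/


namespace ReverseMath

universe u

/-! ### Definability by bounded quantifier formulas -/

/-- The formula obtained by renaming the set variables along `r`. -/
def BddFormula.renameSets (r : ℕ → ℕ) : BddFormula → BddFormula
  | .eq s t => .eq s t
  | .lt s t => .lt s t
  | .mem t i => .mem t (r i)
  | .neg φ => .neg (φ.renameSets r)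
  | .and φ ψ => .and (φ.renameSets r) (ψ.renameSets r)
  | .or φ ψ => .or (φ.renameSets r) (ψ.renameSets r)
  | .ball t φ => .ball t (φ.renameSets r)
  | .bex t φ => .bex t (φ.renameSets r)

section Raw

variable {M : L2Structure.{u}}

theorem BddFormula.holds_renameSets (r : ℕ → ℕ) (W : ℕ → Set M.Num) (φ : BddFormula)
    (v : ℕ → M.Num) : (φ.renameSets r).Holds M W v ↔ φ.Holds M (fun i => W (r i)) v := by
  induction φ generalizing v with
  | eq | lt | mem => rfl
  | neg φ ih => exact not_congr (ih v)
  | and φ ψ ih ih' => exact and_congr (ih v) (ih' v)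
  | or φ ψ ih ih' => exact or_congr (ih v) (ih' v)
  | ball t φ ih => exact forall_congr' fun x => imp_congr_right fun _ => ih _
  | bex t φ ih => exact exists_congr fun x => and_congr_right fun _ => ih _

/-- The function `t` of the assignment of the number variables is given by a term. -/
class TermDef (t : (ℕ → M.Num) → M.Num) : Prop where
  out : ∃ s : NumTerm, ∀ v, s.eval M v = t v

/-- The relation `R` on assignments of the number variables is given by a bounded quantifier
formula with set parameters from `M`. That this is a class lets instance resolution write the
formulas. -/
class BddDef (R : (ℕ → M.Num) → Prop) : Prop where
  out : ∃ (φ : BddFormula) (W : ℕ → Set M.Num), (∀ i, W i ∈ M.Sets) ∧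
    ∀ v, φ.Holds M W v ↔ R v

instance TermDef.var (k : ℕ) : TermDef (M := M) fun v => v k := ⟨.var k, fun _ => rfl⟩

instance TermDef.zero : TermDef (M := M) fun _ => 0 := ⟨.zero, fun _ => rfl⟩

instance TermDef.one : TermDef (M := M) fun _ => 1 := ⟨.one, fun _ => rfl⟩

instance TermDef.add (s t : (ℕ → M.Num) → M.Num) [hs : TermDef s] [ht : TermDef t] :
    TermDef fun v => s v + t v := by
  obtain ⟨s', hs⟩ := hs
  obtain ⟨t', ht⟩ := ht
  exact ⟨.add s' t', fun v => by simp [NumTerm.eval, hs, ht]⟩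

instance TermDef.mul (s t : (ℕ → M.Num) → M.Num) [hs : TermDef s] [ht : TermDef t] :
    TermDef fun v => s v * t v := by
  obtain ⟨s', hs⟩ := hs
  obtain ⟨t', ht⟩ := ht
  exact ⟨.mul s' t', fun v => by simp [NumTerm.eval, hs, ht]⟩

instance BddDef.eq (s t : (ℕ → M.Num) → M.Num) [hs : TermDef s] [ht : TermDef t] :
    BddDef fun v => s v = t v := by
  obtain ⟨s', hs⟩ := hs
  obtain ⟨t', ht⟩ := ht
  obtain ⟨X, hX⟩ := M.sets_nonempty
  exact ⟨.eq s' t', fun _ => X, fun _ => hX, fun v => by simp [BddFormula.Holds, hs, ht]⟩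

instance BddDef.lt (s t : (ℕ → M.Num) → M.Num) [hs : TermDef s] [ht : TermDef t] :
    BddDef fun v => s v < t v := by
  obtain ⟨s', hs⟩ := hs
  obtain ⟨t', ht⟩ := ht
  obtain ⟨X, hX⟩ := M.sets_nonempty
  exact ⟨.lt s' t', fun _ => X, fun _ => hX, fun v => by simp [BddFormula.Holds, hs, ht]⟩

instance BddDef.mem (t : (ℕ → M.Num) → M.Num) (X : Set M.Num) [ht : TermDef t]
    [hX : Fact (X ∈ M.Sets)] : BddDef fun v => t v ∈ X := by
  obtain ⟨t', ht⟩ := ht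
  exact ⟨.mem t' 0, fun _ => X, fun _ => hX.out, fun v => by simp [BddFormula.Holds, ht]⟩

instance BddDef.not (R : (ℕ → M.Num) → Prop) [hR : BddDef R] : BddDef fun v => ¬ R v := by
  obtain ⟨φ, W, hW, hR⟩ := hR
  exact ⟨.neg φ, W, hW, fun v => not_congr (hR v)⟩

/-- Two lists of set parameters are merged into one, the first at the even indices and the second
at the odd indices. -/
theorem exists_merged_params (φ ψ : BddFormula) (W W' : ℕ → Set M.Num) (hW : ∀ i, W i ∈ M.Sets)
    (hW' : ∀ i, W' i ∈ M.Sets) :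
    ∃ (φ' ψ' : BddFormula) (V : ℕ → Set M.Num), (∀ i, V i ∈ M.Sets) ∧
      (∀ v, φ'.Holds M V v ↔ φ.Holds M W v) ∧ ∀ v, ψ'.Holds M V v ↔ ψ.Holds M W' v := by
  refine ⟨φ.renameSets fun i => 2 * i, ψ.renameSets fun i => 2 * i + 1,
    fun i => if i % 2 = 0 then W (i / 2) else W' (i / 2), fun i => ?_, fun v => ?_, fun v => ?_⟩
  · dsimp only
    split_ifs
    exacts [hW _, hW' _]
  · rw [BddFormula.holds_renameSets]
    have : (fun i => if 2 * i % 2 = 0 then W (2 * i / 2) else W' (2 * i / 2)) = W := by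
      funext i
      rw [if_pos (by omega), show 2 * i / 2 = i by omega]
    rw [this]
  · rw [BddFormula.holds_renameSets]
    have : (fun i => if (2 * i + 1) % 2 = 0 then W ((2 * i + 1) / 2) else W' ((2 * i + 1) / 2))
        = W' := by
      funext i
      rw [if_neg (by omega), show (2 * i + 1) / 2 = i by omega]
    rw [this]

instance BddDef.and (R S : (ℕ → M.Num) → Prop) [hR : BddDef R] [hS : BddDef S] :
    BddDef fun v => R v ∧ S v := by
  obtain ⟨φ, W, hW, hR⟩ := hR
  obtain ⟨ψ, W', hW', hS⟩ := hS
  obtain ⟨φ', ψ', V, hV, h, h'⟩ := exists_merged_params φ ψ W W' hW hW'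
  exact ⟨.and φ' ψ', V, hV, fun v => and_congr ((h v).trans (hR v)) ((h' v).trans (hS v))⟩

instance BddDef.or (R S : (ℕ → M.Num) → Prop) [hR : BddDef R] [hS : BddDef S] :
    BddDef fun v => R v ∨ S v := by
  obtain ⟨φ, W, hW, hR⟩ := hR
  obtain ⟨ψ, W', hW', hS⟩ := hS
  obtain ⟨φ', ψ', V, hV, h, h'⟩ := exists_merged_params φ ψ W W' hW hW'
  exact ⟨.or φ' ψ', V, hV, fun v => or_congr ((h v).trans (hR v)) ((h' v).trans (hS v))⟩

instance BddDef.bex (t : (ℕ → M.Num) → M.Num) (R : (ℕ → M.Num) → M.Num → Prop) [ht : TermDef t]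
    [hR : BddDef fun v => R (fun k => v (k + 1)) (v 0)] :
    BddDef fun v => ∃ x, x < t v ∧ R v x := by
  obtain ⟨t', ht⟩ := ht
  obtain ⟨φ, W, hW, hR⟩ := hR
  refine ⟨.bex t' φ, W, hW, fun v => exists_congr fun x => ?_⟩
  rw [ht, hR]
  rfl

instance BddDef.ball (t : (ℕ → M.Num) → M.Num) (R : (ℕ → M.Num) → M.Num → Prop) [ht : TermDef t]
    [hR : BddDef fun v => R (fun k => v (k + 1)) (v 0)] :
    BddDef fun v => ∀ x, x < t v → R v x := by
  obtain ⟨t', ht⟩ := ht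
  obtain ⟨φ, W, hW, hR⟩ := hR
  refine ⟨.ball t' φ, W, hW, fun v => forall_congr' fun x => ?_⟩
  rw [ht, hR]
  rfl

instance BddDef.pair_mem (s t : (ℕ → M.Num) → M.Num) (X : Set M.Num) [TermDef s] [TermDef t]
    [Fact (X ∈ M.Sets)] : BddDef fun v => pair M (s v) (t v) ∈ X := by
  have h : BddDef fun v => (s v < t v ∧ t v * t v + s v ∈ X) ∨
    (¬ s v < t v ∧ s v * s v + s v + t v ∈ X) := inferInstance
  convert h using 2 with v
  unfold pair
  split_ifs with h <;> simp [h]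

instance BddDef.eq_pair (r s t : (ℕ → M.Num) → M.Num) [TermDef r] [TermDef s] [TermDef t] :
    BddDef fun v => r v = pair M (s v) (t v) := by
  have h : BddDef fun v => (s v < t v ∧ r v = t v * t v + s v) ∨
    (¬ s v < t v ∧ r v = s v * s v + s v + t v) := inferInstance
  convert h using 2 with v
  unfold pair
  split_ifs with h <;> simp [h]

variable [hM : Fact (IsModelRCA0 M)]

/-- `Σ⁰₁` induction. In the assignment for `R` the variable `0` is the number `m` that is quantified,
and the variable `1` is the number `n` on which the induction runs. -/
theorem bdd_induction (R : (ℕ → M.Num) → Prop) [hR : BddDef R] (v : ℕ → M.Num)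
    (zero : ∃ m, R (consVal m (consVal 0 v)))
    (succ : ∀ n, (∃ m, R (consVal m (consVal n v))) → ∃ m, R (consVal m (consVal (n + 1) v)))
    (n : M.Num) : ∃ m, R (consVal m (consVal n v)) := by
  obtain ⟨φ, W, hW, hR⟩ := hR
  have := hM.out.sigma01_induction φ v W hW
  simp only [Sigma01, hR] at this
  exact this zero succ n

/-- Induction for a property of `n` without an unbounded quantifier, so that the variable `0` does not
matter. -/
theorem bdd_induction' (R : (ℕ → M.Num) → Prop) [hR : BddDef R] (v : ℕ → M.Num)
    (zero : R (consVal 0 (consVal 0 v)))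
    (succ : ∀ n, R (consVal 0 (consVal n v)) → R (consVal 0 (consVal (n + 1) v)))
    (hm : ∀ m n, R (consVal m (consVal n v)) → R (consVal 0 (consVal n v)))
    (n : M.Num) : R (consVal 0 (consVal n v)) := by
  obtain ⟨m, h⟩ := bdd_induction R v ⟨0, zero⟩ (fun n ⟨m, h⟩ => ⟨0, succ n (hm m n h)⟩) n
  exact hm m n h

/-- `Δ⁰₁` comprehension, with the variables as in `bdd_induction`. -/
theorem bdd_comprehension (R S : (ℕ → M.Num) → Prop) [hR : BddDef R] [hS : BddDef S]
    (v : ℕ → M.Num)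
    (h : ∀ n, (∃ m, R (consVal m (consVal n v))) ↔ ∀ m, S (consVal m (consVal n v))) :
    {n | ∃ m, R (consVal m (consVal n v))} ∈ M.Sets := by
  obtain ⟨φ, W, hW, hR⟩ := hR
  obtain ⟨ψ, W', hW', hS⟩ := hS
  obtain ⟨φ', ψ', V, hV, h₁, h₂⟩ := exists_merged_params φ ψ W W' hW hW'
  have := hM.out.delta01_comprehension φ' ψ' v V hV
  simp only [Sigma01, Pi01, h₁, h₂, hR, hS] at this
  exact this h

/-! ### The ordered semiring of the numbers of a model -/

theorem num_zero_add (n : M.Num) : 0 + n = n :=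
  bdd_induction' (fun e => 0 + e 1 = e 1) (fun _ => 0) (hM.out.add_zero 0)
    (fun n (h : 0 + n = n) => show 0 + (n + 1) = n + 1 by rw [hM.out.add_succ, h])
    (fun _ _ h => h) n

theorem num_succ_add (a n : M.Num) : a + 1 + n = a + n + 1 :=
  bdd_induction' (fun e => e 2 + 1 + e 1 = e 2 + e 1 + 1) (fun _ => a)
    (show a + 1 + 0 = a + 0 + 1 by rw [hM.out.add_zero, hM.out.add_zero])
    (fun n (h : a + 1 + n = a + n + 1) => show a + 1 + (n + 1) = a + (n + 1) + 1 by
      rw [hM.out.add_succ, h, hM.out.add_succ])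
    (fun _ _ h => h) n

theorem num_add_comm (a n : M.Num) : a + n = n + a :=
  bdd_induction' (fun e => e 2 + e 1 = e 1 + e 2) (fun _ => a)
    (show a + 0 = 0 + a by rw [hM.out.add_zero, num_zero_add])
    (fun n (h : a + n = n + a) => show a + (n + 1) = n + 1 + a by
      rw [hM.out.add_succ, h, num_succ_add])
    (fun _ _ h => h) n

theorem num_add_assoc (a b n : M.Num) : a + b + n = a + (b + n) :=
  bdd_induction' (fun e => e 2 + e 3 + e 1 = e 2 + (e 3 + e 1)) (consVal a fun _ => b)
    (show a + b + 0 = a + (b + 0) by rw [hM.out.add_zero, hM.out.add_zero])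
    (fun n (h : a + b + n = a + (b + n)) => show a + b + (n + 1) = a + (b + (n + 1)) by
      rw [hM.out.add_succ, h, hM.out.add_succ, hM.out.add_succ])
    (fun _ _ h => h) n

theorem num_zero_mul (n : M.Num) : 0 * n = 0 :=
  bdd_induction' (fun e => 0 * e 1 = 0) (fun _ => 0) (hM.out.mul_zero 0)
    (fun n (h : 0 * n = 0) => show 0 * (n + 1) = 0 by rw [hM.out.mul_succ, h, hM.out.add_zero])
    (fun _ _ h => h) n

theorem num_succ_mul (a n : M.Num) : (a + 1) * n = a * n + n :=
  bdd_induction' (fun e => (e 2 + 1) * e 1 = e 2 * e 1 + e 1) (fun _ => a)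
    (show (a + 1) * 0 = a * 0 + 0 by simp only [hM.out.mul_zero, hM.out.add_zero])
    (fun n (h : (a + 1) * n = a * n + n) => show (a + 1) * (n + 1) = a * (n + 1) + (n + 1) by
      rw [hM.out.mul_succ, h, hM.out.mul_succ, hM.out.add_succ, hM.out.add_succ (a * n + a) n,
        num_add_assoc _ n, num_add_assoc _ a, num_add_comm n a])
    (fun _ _ h => h) n

theorem num_mul_comm (a n : M.Num) : a * n = n * a :=
  bdd_induction' (fun e => e 2 * e 1 = e 1 * e 2) (fun _ => a)
    (show a * 0 = 0 * a by rw [hM.out.mul_zero, num_zero_mul])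
    (fun n (h : a * n = n * a) => show a * (n + 1) = (n + 1) * a by
      rw [hM.out.mul_succ, h, num_succ_mul])
    (fun _ _ h => h) n

theorem num_mul_add (a b n : M.Num) : a * (b + n) = a * b + a * n :=
  bdd_induction' (fun e => e 2 * (e 3 + e 1) = e 2 * e 3 + e 2 * e 1) (consVal a fun _ => b)
    (show a * (b + 0) = a * b + a * 0 by rw [hM.out.add_zero, hM.out.mul_zero, hM.out.add_zero])
    (fun n (h : a * (b + n) = a * b + a * n) =>
      show a * (b + (n + 1)) = a * b + a * (n + 1) by
        rw [hM.out.add_succ, hM.out.mul_succ, h, hM.out.mul_succ, num_add_assoc])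
    (fun _ _ h => h) n

theorem num_mul_assoc (a b n : M.Num) : a * b * n = a * (b * n) :=
  bdd_induction' (fun e => e 2 * e 3 * e 1 = e 2 * (e 3 * e 1)) (consVal a fun _ => b)
    (show a * b * 0 = a * (b * 0) by simp only [hM.out.mul_zero])
    (fun n (h : a * b * n = a * (b * n)) => show a * b * (n + 1) = a * (b * (n + 1)) by
      rw [hM.out.mul_succ, h, hM.out.mul_succ, num_mul_add])
    (fun _ _ h => h) n

theorem num_add_right_cancel (a b n : M.Num) : a + n = b + n → a = b := by
  have := bdd_induction' (fun e => ¬ (e 2 + e 1 = e 3 + e 1) ∨ e 2 = e 3) (consVal a fun _ => b)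
    (show ¬ (a + 0 = b + 0) ∨ a = b by rw [hM.out.add_zero, hM.out.add_zero]; tauto)
    (fun n (h : ¬ (a + n = b + n) ∨ a = b) => show ¬ (a + (n + 1) = b + (n + 1)) ∨ a = b by
      rw [hM.out.add_succ, hM.out.add_succ]
      refine h.imp_left fun h h' => h (hM.out.succ_inj _ _ h'))
    (fun _ _ h => h) n
  exact fun h => this.resolve_left fun h' => h' h

theorem num_eq_zero_or_succ (n : M.Num) : n = 0 ∨ ∃ m, n = m + 1 := by
  obtain ⟨m, h⟩ := bdd_induction (fun e => e 1 = 0 ∨ e 1 = e 0 + 1) (fun _ => (0 : M.Num))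
    ⟨0, Or.inl rfl⟩ (fun n _ => ⟨n, Or.inr rfl⟩) n
  exact h.imp_right fun h => ⟨m, h⟩

theorem num_lt_iff (a b : M.Num) : a < b ↔ ∃ c, b = a + c + 1 := by
  constructor
  · intro h
    obtain ⟨c, h'⟩ := bdd_induction (fun e => ¬ e 2 < e 1 ∨ e 1 = e 2 + e 0 + 1) (fun _ => a)
      ⟨0, Or.inl (hM.out.not_lt_zero a)⟩
      (fun n ⟨c, (h : ¬ a < n ∨ n = a + c + 1)⟩ => by
        change ∃ c, ¬ a < n + 1 ∨ n + 1 = a + c + 1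
        by_cases hn : a < n + 1
        · rcases (hM.out.lt_succ_iff a n).1 hn with h' | rfl
          · exact ⟨c + 1, Or.inr (by rw [hM.out.add_succ, ← h.resolve_left fun h => h h'])⟩
          · exact ⟨0, Or.inr (by rw [hM.out.add_zero])⟩
        · exact ⟨0, Or.inl hn⟩) b
    exact ⟨c, h'.resolve_left fun h' => h' h⟩
  · rintro ⟨c, rfl⟩
    exact bdd_induction' (fun e => e 2 < e 2 + e 1 + 1) (fun _ => a)
      (show a < a + 0 + 1 from (hM.out.lt_succ_iff _ _).2 (Or.inr (hM.out.add_zero a).symm))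
      (fun n (h : a < a + n + 1) => show a < a + (n + 1) + 1 from
        (hM.out.lt_succ_iff _ _).2 (Or.inl (by rwa [hM.out.add_succ])))
      (fun _ _ h => h) c

theorem num_lt_trichotomy (a b : M.Num) : a < b ∨ a = b ∨ b < a := by
  obtain ⟨c, h⟩ := bdd_induction (fun e => e 2 + e 0 = e 1 ∨ e 1 + e 0 = e 2) (fun _ => b)
    ⟨b, Or.inr (num_zero_add b)⟩
    (fun n ⟨c, (h : b + c = n ∨ n + c = b)⟩ => by
      change ∃ c, b + c = n + 1 ∨ n + 1 + c = b
      rcases h with h | h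
      · exact ⟨c + 1, Or.inl (by rw [hM.out.add_succ, h])⟩
      · rcases num_eq_zero_or_succ c with rfl | ⟨c, rfl⟩
        · exact ⟨1, Or.inl (by rw [← h, hM.out.add_zero])⟩
        · exact ⟨c, Or.inr (by rw [num_succ_add, ← hM.out.add_succ, h])⟩) a
  change b + c = a ∨ a + c = b at h
  simp only [num_lt_iff]
  rcases num_eq_zero_or_succ c with rfl | ⟨c, rfl⟩
  · rw [hM.out.add_zero, hM.out.add_zero] at h
    exact Or.inr (Or.inl (h.elim Eq.symm id))
  · rw [hM.out.add_succ, hM.out.add_succ] at h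
    exact h.elim (fun h => Or.inr (Or.inr ⟨c, h.symm⟩)) fun h => Or.inl ⟨c, h.symm⟩

theorem num_lt_irrefl (a : M.Num) : ¬ a < a := by
  rw [num_lt_iff]
  rintro ⟨c, h⟩
  refine hM.out.succ_ne_zero c (num_add_right_cancel _ _ a ?_)
  rw [num_zero_add, num_add_comm, hM.out.add_succ, ← h]

theorem num_lt_trans {a b c : M.Num} (h : a < b) (h' : b < c) : a < c := by
  rw [num_lt_iff] at *
  obtain ⟨d, rfl⟩ := h
  obtain ⟨e, rfl⟩ := h'
  exact ⟨d + 1 + e, by simp only [num_add_assoc]⟩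

noncomputable instance : CommSemiring M.Num where
  add_assoc := num_add_assoc
  zero_add := num_zero_add
  add_zero := hM.out.add_zero
  add_comm := num_add_comm
  nsmul := nsmulRec
  left_distrib := num_mul_add
  right_distrib a b c := by rw [num_mul_comm, num_mul_add, num_mul_comm c, num_mul_comm c]
  zero_mul := num_zero_mul
  mul_zero := hM.out.mul_zero
  mul_assoc := num_mul_assoc
  one_mul n := by
    rw [num_mul_comm, ← num_zero_add 1, hM.out.mul_succ, hM.out.mul_zero, num_zero_add]
  mul_one n := by rw [← num_zero_add 1, hM.out.mul_succ, hM.out.mul_zero, num_zero_add]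
  mul_comm := num_mul_comm

noncomputable instance : LinearOrder M.Num where
  le a b := a < b ∨ a = b
  lt a b := a < b
  le_refl a := Or.inr rfl
  le_trans a b c := by
    rintro (h | rfl) (h' | rfl)
    exacts [Or.inl (num_lt_trans h h'), Or.inl h, Or.inl h', Or.inr rfl]
  lt_iff_le_not_ge a b := by
    constructor
    · intro h
      refine ⟨Or.inl h, ?_⟩
      rintro (h' | rfl)
      exacts [num_lt_irrefl _ (num_lt_trans h h'), num_lt_irrefl _ h]
    · rintro ⟨h | rfl, h'⟩
      exacts [h, (h' (Or.inr rfl)).elim]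
  le_antisymm a b := by
    rintro (h | rfl) (h' | h')
    exacts [(num_lt_irrefl _ (num_lt_trans h h')).elim, h'.symm, rfl, rfl]
  le_total a b := by
    rcases num_lt_trichotomy a b with h | h | h
    exacts [Or.inl (Or.inl h), Or.inl (Or.inr h), Or.inr (Or.inl h)]
  toDecidableLE := Classical.decRel _

theorem num_add_lt_add_left {a b : M.Num} (h : a < b) (c : M.Num) : c + a < c + b := by
  obtain ⟨d, rfl⟩ := (num_lt_iff a b).1 h
  exact (num_lt_iff _ _).2 ⟨d, by simp only [num_add_assoc]⟩

instance : CanonicallyOrderedAdd M.Num where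
  exists_add_of_le {a b} h := by
    rcases h with h | rfl
    · obtain ⟨c, rfl⟩ := (num_lt_iff a b).1 h
      exact ⟨c + 1, by simp only [num_add_assoc]⟩
    · exact ⟨0, (add_zero a).symm⟩
  le_add_self a b := by
    rcases num_eq_zero_or_succ b with rfl | ⟨c, rfl⟩
    · exact Or.inr (zero_add a).symm
    · exact Or.inl ((num_lt_iff _ _).2 ⟨c, by rw [num_add_comm, num_add_assoc]⟩)
  le_self_add a b := by
    rcases num_eq_zero_or_succ b with rfl | ⟨c, rfl⟩
    · exact Or.inr (add_zero a).symm
    · exact Or.inl ((num_lt_iff _ _).2 ⟨c, by rw [num_add_assoc]⟩)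

instance : IsStrictOrderedRing M.Num where
  add_le_add_left a b h c := by
    rcases h with h | rfl
    · exact Or.inl (by simpa only [add_comm _ c] using num_add_lt_add_left h c)
    · exact le_rfl
  le_of_add_le_add_left a b c h := by
    by_contra h'
    exact (num_add_lt_add_left (not_le.1 h') a).not_ge h
  zero_le_one := zero_le
  exists_pair_ne := ⟨0, 1, fun h => hM.out.succ_ne_zero 0 (by rw [zero_add, ← h])⟩
  mul_lt_mul_of_pos_left a ha b c h := by
    obtain ⟨d, rfl⟩ := (num_lt_iff _ _).1 h
    obtain ⟨e, rfl⟩ := (num_lt_iff _ _).1 ha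
    exact (num_lt_iff _ _).2 ⟨(0 + e + 1) * d + e, by ring⟩
  mul_lt_mul_of_pos_right a ha b c h := by
    obtain ⟨d, rfl⟩ := (num_lt_iff _ _).1 h
    obtain ⟨e, rfl⟩ := (num_lt_iff _ _).1 ha
    exact (num_lt_iff _ _).2 ⟨(0 + e + 1) * d + e, by ring⟩

end Raw

section Arithmetic

variable {M : L2Structure.{u}} [hM : Fact (IsModelRCA0 M)]

theorem num_lt_add_one_iff {a b : M.Num} : a < b + 1 ↔ a ≤ b := hM.out.lt_succ_iff a b

theorem num_add_one_le_iff {a b : M.Num} : a + 1 ≤ b ↔ a < b := by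
  rw [← not_lt, num_lt_add_one_iff, not_le]

theorem num_lt_add_one (a : M.Num) : a < a + 1 := num_lt_add_one_iff.2 le_rfl

theorem num_le_mul_self (a : M.Num) : a ≤ a * a := by
  rcases num_eq_zero_or_succ a with rfl | ⟨b, rfl⟩
  · exact zero_le
  · calc b + 1 ≤ b + 1 + (b * b + b) := le_self_add
      _ = (b + 1) * (b + 1) := by ring

/-! ### The pairing function -/

theorem le_pair_left (a b : M.Num) : a ≤ pair M a b := by
  unfold pair
  split_ifs
  · exact le_add_self
  · exact le_add_right le_add_self

theorem le_pair_right (a b : M.Num) : b ≤ pair M a b := by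
  unfold pair
  split_ifs
  · exact le_add_right (num_le_mul_self b)
  · exact le_add_self

theorem exists_eq_pair (z : M.Num) : ∃ a b, z = pair M a b := by
  have h := bdd_induction' (fun e => ∃ a, a < e 1 + 1 ∧ ∃ b, b < e 1 + 1 ∧ e 1 = pair M a b)
    (fun _ => (0 : M.Num)) ⟨0, num_lt_add_one _, 0, num_lt_add_one _, by simp [pair, consVal]⟩ ?_
    (fun _ _ h => h) z
  · obtain ⟨a, -, b, -, h⟩ := h
    exact ⟨a, b, h⟩
  · intro n
    suffices h : (∃ a b, n = pair M a b) → ∃ a b, n + 1 = pair M a b by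
      rintro ⟨a, -, b, -, hn⟩
      obtain ⟨a, b, h⟩ := h ⟨a, b, hn⟩
      refine ⟨a, ?_, b, ?_, h⟩
      · exact num_lt_add_one_iff.2 (h ▸ le_pair_left a b)
      · exact num_lt_add_one_iff.2 (h ▸ le_pair_right a b)
    rintro ⟨a, b, rfl⟩
    unfold pair
    split_ifs with h
    · obtain ⟨c, rfl⟩ := (num_lt_iff _ _).1 h
      by_cases hc : c = 0
      · subst hc
        refine ⟨a + 1, 0, ?_⟩
        rw [if_neg not_lt_zero]
        ring
      · refine ⟨a + 1, a + c + 1, ?_⟩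
        rw [if_pos (by simpa [num_lt_iff, add_right_comm] using (pos_iff_ne_zero.2 hc)), add_assoc]
    · rcases (not_lt.1 h).lt_or_eq with h | rfl
      · refine ⟨a, b + 1, ?_⟩
        rw [if_neg (not_lt.2 (num_add_one_le_iff.2 h)), add_assoc _ b]
      · refine ⟨0, b + 1, ?_⟩
        rw [if_pos (lt_of_le_of_lt zero_le (num_lt_add_one b))]
        ring

theorem pair_lt_pair_right (a : M.Num) {b b' : M.Num} (h : b < b') : pair M a b < pair M a b' := by
  unfold pair
  split_ifs with h₁ h₂ h₂
  · gcongr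
  · exact (h₂ (h₁.trans h)).elim
  · obtain ⟨c, rfl⟩ := (num_lt_iff _ _).1 h₂
    calc a * a + a + b ≤ a * a + a + a := by gcongr; exact not_lt.1 h₁
      _ < a * a + a + a + 1 := num_lt_add_one _
      _ ≤ a * a + a + a + 1 + (a + (2 * a * c + c * c + 2 * c)) := le_self_add
      _ = _ := by ring
  · gcongr

theorem pair_inj {a b c d : M.Num} : pair M a b = pair M c d ↔ a = c ∧ b = d := by
  refine ⟨fun h => ?_, fun ⟨h, h'⟩ => by rw [h, h']⟩
  -- The larger entry `m` of a pair is determined, since the code is in `[m², (m + 1)²)`.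
  have lo (a b : M.Num) : max a b * max a b ≤ pair M a b := by
    unfold pair
    split_ifs with h
    · rw [max_eq_right h.le]; exact le_self_add
    · rw [max_eq_left (not_lt.1 h), add_assoc]; exact le_self_add
  have hi (a b : M.Num) : pair M a b < (max a b + 1) * (max a b + 1) := by
    unfold pair
    split_ifs with h
    · rw [max_eq_right h.le]
      calc b * b + a < b * b + b := by gcongr
        _ ≤ b * b + b + (b + 1) := le_self_add
        _ = _ := by ring
    · rw [max_eq_left (not_lt.1 h)]
      calc a * a + a + b ≤ a * a + a + a := by gcongr; exact not_lt.1 h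
        _ < a * a + a + a + 1 := num_lt_add_one _
        _ = _ := by ring
  have key {a b c d : M.Num} (h : pair M a b = pair M c d) : max a b ≤ max c d := by
    by_contra h'
    have h' := num_add_one_le_iff.2 (not_le.1 h')
    exact (((lo a b).trans_lt (h ▸ hi c d)).trans_le (mul_le_mul' h' h')).false
  have hm := (key h).antisymm (key h.symm)
  unfold pair at h
  split_ifs at h with h₁ h₂ h₂
  · rw [max_eq_right h₁.le, max_eq_right h₂.le] at hm
    subst hm
    exact ⟨add_left_cancel h, rfl⟩
  · rw [max_eq_right h₁.le, max_eq_left (not_lt.1 h₂)] at hm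
    subst hm
    rw [add_assoc] at h
    exact absurd (add_left_cancel h) (h₁.trans_le le_self_add).ne
  · rw [max_eq_left (not_lt.1 h₁), max_eq_right h₂.le] at hm
    subst hm
    rw [add_assoc] at h
    exact absurd (add_left_cancel h).symm (h₂.trans_le le_self_add).ne
  · rw [max_eq_left (not_lt.1 h₁), max_eq_left (not_lt.1 h₂)] at hm
    subst hm
    exact ⟨rfl, add_left_cancel h⟩

/-- The first entry of the pair with code `z`. -/
noncomputable def fst (z : M.Num) : M.Num := (exists_eq_pair z).choose

/-- The second entry of the pair with code `z`. -/
noncomputable def snd (z : M.Num) : M.Num := (exists_eq_pair z).choose_spec.choose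

@[simp] theorem pair_fst_snd (z : M.Num) : pair M (fst z) (snd z) = z :=
  (exists_eq_pair z).choose_spec.choose_spec.symm

@[simp] theorem fst_pair (a b : M.Num) : fst (pair M a b) = a :=
  (pair_inj.1 (pair_fst_snd (pair M a b))).1

@[simp] theorem snd_pair (a b : M.Num) : snd (pair M a b) = b :=
  (pair_inj.1 (pair_fst_snd (pair M a b))).2

theorem eq_pair_iff {z a b : M.Num} : z = pair M a b ↔ a = fst z ∧ b = snd z := by
  rw [← pair_inj, pair_fst_snd, eq_comm]

theorem fst_le (z : M.Num) : fst z ≤ z := by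
  simpa using le_pair_left (fst z) (snd z)

theorem snd_le (z : M.Num) : snd z ≤ z := by
  simpa using le_pair_right (fst z) (snd z)

/-! ### Predicates and functions that exist in a model -/

/-- The predicate `P` is given by a set of the model. The closure properties below are instances,
so that `Δ⁰₁` comprehension is carried out by instance resolution; predicates of several numbers
are predicates of a pair. -/
class DeltaPred (P : M.Num → Prop) : Prop where
  mem : {z | P z} ∈ M.Sets

/-- The graph of the function `f` is a set of the model. -/
class DeltaFun (f : M.Num → M.Num) : Prop where
  mem : {z | snd z = f (fst z)} ∈ M.Sets

theorem DeltaFun.pair_mem_iff (f : M.Num → M.Num) (x y : M.Num) :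
    pair M x y ∈ {z | snd z = f (fst z)} ↔ y = f x := by simp

theorem DeltaPred.of_bdd (P : M.Num → Prop) (R : (ℕ → M.Num) → Prop) [BddDef R] (v : ℕ → M.Num)
    (h : ∀ m z, R (consVal m (consVal z v)) ↔ P z) : DeltaPred P := by
  refine ⟨?_⟩
  convert bdd_comprehension R R v (fun n => ?_) using 3 with n
  · exact ⟨fun hn => ⟨0, (h 0 n).2 hn⟩, fun ⟨m, hn⟩ => (h m n).1 hn⟩
  · simp only [h]
    exact ⟨fun ⟨_, h⟩ _ => h, fun h => ⟨0, h 0⟩⟩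

/-- The function `f` exists if its graph is `∃ m, Q x y m` for a bounded formula `Q`: the complement of
the graph consists of the pairs `(x, y)` with `Q x y' m` for some `m` and some `y' ≠ y`. The two
formulas that define the graph are written by instance resolution. -/
theorem DeltaFun.of_bdd (f : M.Num → M.Num) (Q : M.Num → M.Num → M.Num → (ℕ → M.Num) → Prop)
    (v : ℕ → M.Num)
    [BddDef fun e : ℕ → M.Num => ∃ x, x < e 1 + 1 ∧ ∃ y, y < e 1 + 1 ∧
      e 1 = pair M x y ∧ Q x y (e 0) fun k => e (k + 2)]
    [BddDef fun e : ℕ → M.Num => ∀ x, x < e 1 + 1 → ∀ y, y < e 1 + 1 → ∀ m, m < e 0 →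
      ∀ y', y' < e 0 → ¬ (e 1 = pair M x y ∧ Q x y' m (fun k => e (k + 2)) ∧ ¬ y = y')]
    (h : ∀ x y, y = f x ↔ ∃ m, Q x y m v) : DeltaFun f := by
  have key : ∀ z : M.Num, snd z = f (fst z) ↔ ∃ m x, x < z + 1 ∧ ∃ y, y < z + 1 ∧
      z = pair M x y ∧ Q x y m v := by
    intro z
    rw [h]
    refine exists_congr fun m => ⟨fun hm => ?_, ?_⟩
    · exact ⟨fst z, num_lt_add_one_iff.2 (fst_le z), snd z, num_lt_add_one_iff.2 (snd_le z),
        by simp, hm⟩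
    · rintro ⟨x, -, y, -, rfl, hm⟩
      simpa using hm
  refine ⟨?_⟩
  rw [show {z | snd z = f (fst z)} = _ from Set.ext key]
  refine bdd_comprehension (fun e => ∃ x, x < e 1 + 1 ∧ ∃ y, y < e 1 + 1 ∧
      e 1 = pair M x y ∧ Q x y (e 0) fun k => e (k + 2))
    (fun e => ∀ x, x < e 1 + 1 → ∀ y, y < e 1 + 1 → ∀ m, m < e 0 →
      ∀ y', y' < e 0 → ¬ (e 1 = pair M x y ∧ Q x y' m (fun k => e (k + 2)) ∧ ¬ y = y')) v
    fun n => (key n).symm.trans ⟨?_, fun H => ?_⟩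
  · rintro hz w x - y - m - y' - ⟨h₁, h₂, h₃⟩
    change n = pair M x y at h₁
    subst h₁
    simp only [fst_pair, snd_pair] at hz
    exact h₃ (hz.trans ((h x y').2 ⟨m, h₂⟩).symm)
  · obtain ⟨m, hm⟩ := (h (fst n) (f (fst n))).1 rfl
    by_contra hz
    refine H (m + f (fst n) + 1) (fst n) (num_lt_add_one_iff.2 (fst_le n)) (snd n)
        (num_lt_add_one_iff.2 (snd_le n)) m (num_lt_add_one_iff.2 le_self_add)
        (f (fst n)) (num_lt_add_one_iff.2 le_add_self) ⟨(pair_fst_snd n).symm, hm, hz⟩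

instance DeltaFun.id : DeltaFun fun z : M.Num => z :=
  .of_bdd _ (fun x y _ _ => y = x) (fun _ => 0) (by simp)

instance DeltaFun.const (a : M.Num) : DeltaFun fun _ : M.Num => a :=
  .of_bdd _ (fun _ y _ e => y = e 0) (fun _ => a) (by simp)

theorem DeltaFun.comp (f g : M.Num → M.Num) [hf : DeltaFun f] [hg : DeltaFun g] :
    DeltaFun fun z => f (g z) := by
  have := Fact.mk hf.mem
  have := Fact.mk hg.mem
  refine .of_bdd _ (fun x y m _ => pair M x m ∈ {z | snd z = g (fst z)} ∧
    pair M m y ∈ {z | snd z = f (fst z)}) (fun _ => 0) ?_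
  simp

instance DeltaFun.fst_fun : DeltaFun (fst : M.Num → M.Num) :=
  .of_bdd _ (fun x y m _ => x = pair M y m) (fun _ => 0) (by simp [eq_pair_iff])

instance DeltaFun.snd_fun : DeltaFun (snd : M.Num → M.Num) :=
  .of_bdd _ (fun x y m _ => x = pair M m y) (fun _ => 0) (by simp [eq_pair_iff])

instance DeltaFun.fst_comp (f : M.Num → M.Num) [DeltaFun f] : DeltaFun fun z => fst (f z) :=
  .comp fst f

instance DeltaFun.snd_comp (f : M.Num → M.Num) [DeltaFun f] : DeltaFun fun z => snd (f z) :=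
  .comp snd f

instance DeltaFun.pair_comp (f g : M.Num → M.Num) [hf : DeltaFun f] [hg : DeltaFun g] :
    DeltaFun fun z => pair M (f z) (g z) := by
  have := Fact.mk hf.mem
  have := Fact.mk hg.mem
  refine .of_bdd _ (fun x y _ _ => ∃ a, a < y + 1 ∧ ∃ b, b < y + 1 ∧ y = pair M a b ∧
    pair M x a ∈ {z | snd z = f (fst z)} ∧
    pair M x b ∈ {z | snd z = g (fst z)}) (fun _ => 0) ?_
  intro x y
  simp only [DeltaFun.pair_mem_iff, exists_const]
  constructor
  · rintro rfl
    exact ⟨_, num_lt_add_one_iff.2 (le_pair_left _ _), _, num_lt_add_one_iff.2 (le_pair_right _ _),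
      rfl, rfl, rfl⟩
  · rintro ⟨a, -, b, -, rfl, rfl, rfl⟩
    rfl

instance DeltaFun.pair_left (a : M.Num) : DeltaFun (pair M a) :=
  .pair_comp (fun _ => a) fun z => z

theorem DeltaFun.fst_add_snd : DeltaFun fun z : M.Num => fst z + snd z := by
  refine .of_bdd _ (fun x y _ _ => ∃ a, a < x + 1 ∧ ∃ b, b < x + 1 ∧ x = pair M a b ∧
    y = a + b) (fun _ => 0) ?_
  intro x y
  simp only [exists_const]
  constructor
  · rintro rfl
    exact ⟨_, num_lt_add_one_iff.2 (fst_le _), _, num_lt_add_one_iff.2 (snd_le _), by simp, rfl⟩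
  · rintro ⟨a, -, b, -, rfl, rfl⟩
    simp

theorem DeltaFun.fst_mul_snd : DeltaFun fun z : M.Num => fst z * snd z := by
  refine .of_bdd _ (fun x y _ _ => ∃ a, a < x + 1 ∧ ∃ b, b < x + 1 ∧ x = pair M a b ∧
    y = a * b) (fun _ => 0) ?_
  intro x y
  simp only [exists_const]
  constructor
  · rintro rfl
    exact ⟨_, num_lt_add_one_iff.2 (fst_le _), _, num_lt_add_one_iff.2 (snd_le _), by simp, rfl⟩
  · rintro ⟨a, -, b, -, rfl, rfl⟩
    simp

instance DeltaFun.add (f g : M.Num → M.Num) [DeltaFun f] [DeltaFun g] :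
    DeltaFun fun z => f z + g z := by
  have := DeltaFun.fst_add_snd (M := M)
  simpa using DeltaFun.comp (fun z : M.Num => fst z + snd z)
    (fun z => pair M (f z) (g z))

instance DeltaFun.mul (f g : M.Num → M.Num) [DeltaFun f] [DeltaFun g] :
    DeltaFun fun z => f z * g z := by
  have := DeltaFun.fst_mul_snd (M := M)
  simpa using DeltaFun.comp (fun z : M.Num => fst z * snd z)
    (fun z => pair M (f z) (g z))

theorem DeltaPred.comp (P : M.Num → Prop) (f : M.Num → M.Num) [hP : DeltaPred P]
    [hf : DeltaFun f] : DeltaPred fun z => P (f z) := by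
  have := Fact.mk hP.mem
  have := Fact.mk hf.mem
  refine ⟨?_⟩
  convert bdd_comprehension
    (fun e => pair M (e 1) (e 0) ∈ {z | snd z = f (fst z)} ∧
      e 0 ∈ {z | P z})
    (fun e => ¬ (pair M (e 1) (e 0) ∈ {z | snd z = f (fst z)} ∧
      ¬ e 0 ∈ {z | P z})) (fun _ => 0) (fun n => ?_) using 3 with n
  · simp [consVal]
  · simp [consVal]

instance DeltaPred.mem_set (f : M.Num → M.Num) (X : Set M.Num) [DeltaFun f]
    [hX : Fact (X ∈ M.Sets)] : DeltaPred fun z => f z ∈ X :=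
  haveI : DeltaPred fun z => z ∈ X := ⟨hX.out⟩
  .comp (fun z => z ∈ X) f

instance DeltaPred.fact_mem (P : M.Num → Prop) [h : DeltaPred P] : Fact ({z | P z} ∈ M.Sets) :=
  ⟨h.mem⟩

instance DeltaPred.not (P : M.Num → Prop) [hP : DeltaPred P] : DeltaPred fun z => ¬ P z :=
  .of_bdd _ (fun e => ¬ e 1 ∈ {z | P z}) (fun _ => 0) fun _ _ => Iff.rfl

instance DeltaPred.and (P Q : M.Num → Prop) [hP : DeltaPred P] [hQ : DeltaPred Q] :
    DeltaPred fun z => P z ∧ Q z :=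
  .of_bdd _ (fun e => e 1 ∈ {z | P z} ∧ e 1 ∈ {z | Q z}) (fun _ => 0) fun _ _ => Iff.rfl

instance DeltaPred.or (P Q : M.Num → Prop) [hP : DeltaPred P] [hQ : DeltaPred Q] :
    DeltaPred fun z => P z ∨ Q z :=
  .of_bdd _ (fun e => e 1 ∈ {z | P z} ∨ e 1 ∈ {z | Q z}) (fun _ => 0) fun _ _ => Iff.rfl

instance DeltaPred.imp (P Q : M.Num → Prop) [hP : DeltaPred P] [hQ : DeltaPred Q] :
    DeltaPred fun z => P z → Q z := by
  simp only [imp_iff_not_or]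
  infer_instance

instance DeltaPred.iff (P Q : M.Num → Prop) [hP : DeltaPred P] [hQ : DeltaPred Q] :
    DeltaPred fun z => P z ↔ Q z := by
  simp only [iff_iff_implies_and_implies]
  infer_instance

instance DeltaPred.eq (f g : M.Num → M.Num) [DeltaFun f] [DeltaFun g] :
    DeltaPred fun z => f z = g z := by
  have : DeltaPred fun z : M.Num => fst z = snd z := by
    refine .of_bdd _ (fun e => ∃ a, a < e 1 + 1 ∧ e 1 = pair M a a) (fun _ => 0)
      fun _ z => ⟨?_, fun h => ⟨fst z, num_lt_add_one_iff.2 (fst_le z), ?_⟩⟩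
    · rintro ⟨a, -, h⟩
      change z = _ at h
      simp [h]
    · exact eq_pair_iff.2 ⟨rfl, h⟩
  simpa using DeltaPred.comp (fun z : M.Num => fst z = snd z)
    (fun z => pair M (f z) (g z))

instance DeltaPred.lt (f g : M.Num → M.Num) [DeltaFun f] [DeltaFun g] :
    DeltaPred fun z => f z < g z := by
  have : DeltaPred fun z : M.Num => fst z < snd z := by
    refine .of_bdd _ (fun e => ∃ a, a < e 1 + 1 ∧ ∃ b, b < e 1 + 1 ∧ e 1 = pair M a b ∧
      a < b) (fun _ => 0)
      fun _ z => ⟨?_, fun h => ⟨fst z, num_lt_add_one_iff.2 (fst_le z), snd z,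
        num_lt_add_one_iff.2 (snd_le z), (pair_fst_snd z).symm, h⟩⟩
    rintro ⟨a, -, b, -, h, hab⟩
    change z = _ at h
    simp [h, hab]
  simpa using DeltaPred.comp (fun z : M.Num => fst z < snd z)
    (fun z => pair M (f z) (g z))

instance DeltaPred.le (f g : M.Num → M.Num) [DeltaFun f] [DeltaFun g] :
    DeltaPred fun z => f z ≤ g z := by
  simp only [← not_lt]
  infer_instance

/-! Partially applied functions and relations, which are what remains of a body such as
`fun x => a ≤ x`. -/

instance DeltaPred.eq_left (a : M.Num) : DeltaPred (Eq a) := .eq (fun _ => a) fun z => z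

instance DeltaPred.le_left (a : M.Num) : DeltaPred (LE.le a) := .le (fun _ => a) fun z => z

instance DeltaPred.mem_left (X : Set M.Num) [Fact (X ∈ M.Sets)] : DeltaPred (Membership.mem X) :=
  .mem_set (fun z => z) X

instance DeltaPred.bex (f : M.Num → M.Num) (P : M.Num → M.Num → Prop) [hf : DeltaFun f]
    [hP : DeltaPred fun w => P (fst w) (snd w)] : DeltaPred fun z => ∃ x, x < f z ∧ P z x := by
  have := Fact.mk hf.mem
  have : DeltaPred fun z : M.Num => ∃ x, x < snd z ∧ P (fst z) x := by
    refine .of_bdd _ (fun e => ∃ a, a < e 1 + 1 ∧ ∃ b, b < e 1 + 1 ∧ e 1 = pair M a b ∧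
      ∃ x, x < b ∧ pair M a x ∈ {w | P (fst w) (snd w)})
      (fun _ => 0) fun _ z => ⟨?_, fun h => ⟨fst z, num_lt_add_one_iff.2 (fst_le z),
        snd z, num_lt_add_one_iff.2 (snd_le z), (pair_fst_snd z).symm, by simpa⟩⟩
    rintro ⟨a, -, b, -, h, hab⟩
    change z = _ at h
    simpa [h] using hab
  simpa using DeltaPred.comp
    (fun z : M.Num => ∃ x, x < snd z ∧ P (fst z) x)
    (fun z => pair M z (f z))

instance DeltaPred.ball (f : M.Num → M.Num) (P : M.Num → M.Num → Prop) [hf : DeltaFun f]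
    [hP : DeltaPred fun w => P (fst w) (snd w)] : DeltaPred fun z => ∀ x, x < f z → P z x := by
  have : DeltaPred fun z : M.Num => ¬ ∃ x, x < f z ∧ ¬ P z x := inferInstance
  simpa only [not_exists, not_and, not_not] using this

/-- `Δ⁰₁` comprehension. Here and below, the hypothesis that a predicate exists in the model is left to
instance resolution when the predicate is known. -/
theorem DeltaPred.of_sigma_pi (P : M.Num → Prop) (Q R : M.Num → M.Num → Prop)
    (hQ : ∀ z, P z ↔ ∃ m, Q z m) (hR : ∀ z, P z ↔ ∀ m, R z m)
    (_ : DeltaPred fun w => Q (fst w) (snd w) := by infer_instance)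
    (_ : DeltaPred fun w => R (fst w) (snd w) := by infer_instance) : DeltaPred P := by
  refine ⟨?_⟩
  convert bdd_comprehension
    (fun e => pair M (e 1) (e 0) ∈ {w | Q (fst w) (snd w)})
    (fun e => pair M (e 1) (e 0) ∈ {w | R (fst w) (snd w)}) (fun _ => 0)
    (fun n => ?_) using 3 with n
  · simp [consVal, hQ]
  · simp [consVal, ← hQ, ← hR]

/-- `Σ⁰₁` induction. -/
theorem sigma_induction (Q : M.Num → M.Num → Prop)
    (zero : ∃ m, Q 0 m) (succ : ∀ n, (∃ m, Q n m) → ∃ m, Q (n + 1) m) (n : M.Num)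
    (_ : DeltaPred fun w => Q (fst w) (snd w) := by infer_instance) : ∃ m, Q n m := by
  have := bdd_induction (fun e => pair M (e 1) (e 0) ∈ {w | Q (fst w) (snd w)}) (fun _ => 0)
  simp only [consVal, Set.mem_ofPred_eq, fst_pair, snd_pair] at this
  exact this zero succ n

theorem delta_induction (P : M.Num → Prop) (zero : P 0) (succ : ∀ n, P n → P (n + 1)) (n : M.Num)
    (_ : DeltaPred P := by infer_instance) : P n := by
  have : DeltaPred fun w : M.Num => P (fst w) := .comp P _
  have := sigma_induction (fun n _ => P n)
  simp only [exists_const] at this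
  exact this zero succ n

theorem delta_strong_induction (P : M.Num → Prop) (ind : ∀ n, (∀ k, k < n → P k) → P n) (n : M.Num)
    (_ : DeltaPred P := by infer_instance) : P n := by
  have : DeltaPred fun w : M.Num => P (snd w) := .comp P _
  refine ind n (delta_induction (fun n => ∀ k, k < n → P k) ?_ ?_ n)
  · exact fun k hk => (not_lt_zero hk).elim
  · intro n hn k hk
    rcases (num_lt_add_one_iff.1 hk).lt_or_eq with h | rfl
    exacts [hn k h, ind k hn]

theorem exists_least (P : M.Num → Prop) (h : ∃ n, P n) (_ : DeltaPred P := by infer_instance) :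
    ∃ n, P n ∧ ∀ k, k < n → ¬ P k := by
  by_contra! H
  obtain ⟨n, hn⟩ := h
  refine delta_strong_induction (fun n => ¬ P n) (fun n ih hn => ?_) n inferInstance hn
  obtain ⟨k, hk, hP⟩ := H n hn
  exact ih k hk hP

theorem DeltaFun.of_graph (f : M.Num → M.Num) (h : DeltaPred fun w => snd w = f (fst w)) :
    DeltaFun f := ⟨h.mem⟩

/-- A function with a `Σ⁰₁` graph exists, since its graph is also `Π⁰₁`. -/
theorem DeltaFun.of_sigma_graph (f : M.Num → M.Num) (Q : M.Num → M.Num → M.Num → Prop)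
    (h : ∀ x y, y = f x ↔ ∃ m, Q x y m)
    (_ : DeltaPred fun w => Q (fst (fst w)) (snd (fst w)) (snd w) := by infer_instance) :
    DeltaFun f := by
  have : DeltaPred fun w : M.Num =>
      Q (fst (fst w)) (fst (snd w))
        (snd (snd w)) := by
    simpa using DeltaPred.comp (fun w : M.Num => Q (fst (fst w))
      (snd (fst w)) (snd w))
      (fun w : M.Num => pair M (pair M (fst (fst w))
        (fst (snd w))) (snd (snd w)))
  refine .of_graph _ (.of_sigma_pi _
    (fun z m => Q (fst z) (snd z) m)
    (fun z m => Q (fst z) (fst m) (snd m) →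
      fst m = snd z) (fun z => h _ _) fun z => ⟨fun hz m hm => ?_,
      fun H => ?_⟩)
  · rw [hz, h]
    exact ⟨_, hm⟩
  · obtain ⟨m, hm⟩ := (h (fst z) _).1 rfl
    simpa using (H (pair M (f (fst z)) m) (by simpa using hm)).symm

/-- Unbounded search; `f x` is the least number that stands in the relation `P` to `x`. -/
theorem exists_search (P : M.Num → M.Num → Prop) (h : ∀ x, ∃ y, P x y)
    (_ : DeltaPred fun w => P (fst w) (snd w) := by infer_instance) :
    ∃ f : M.Num → M.Num, DeltaFun f ∧ ∀ x, P x (f x) := by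
  have hx (x : M.Num) : DeltaPred fun y => P x y := by
    simpa using DeltaPred.comp (fun w => P (fst w) (snd w)) (fun y => pair M x y)
  choose f hf hf' using fun x => exists_least (P x) (h x)
  have : DeltaPred fun w : M.Num => P (fst (fst w)) (snd w) := by
    simpa using DeltaPred.comp (fun w => P (fst w) (snd w)) (fun w => pair M (fst (fst w)) (snd w))
  refine ⟨f, ⟨?_⟩, hf⟩
  convert DeltaPred.mem (P := fun w => P (fst w) (snd w) ∧ ∀ y, y < snd w → ¬ P (fst w) y) using 3
    with w
  refine ⟨fun h => by rw [h]; exact ⟨hf _, hf' _⟩, fun ⟨h₁, h₂⟩ => ?_⟩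
  rcases lt_trichotomy (snd w) (f (fst w)) with h | h | h
  exacts [(hf' _ _ h h₁).elim, h, (h₂ _ h (hf _)).elim]

theorem DeltaFun.comp₂ (h : M.Num → M.Num → M.Num) (f g : M.Num → M.Num)
    [DeltaFun fun w => h (fst w) (snd w)] [DeltaFun f] [DeltaFun g] :
    DeltaFun fun z => h (f z) (g z) := by
  simpa using DeltaFun.comp (fun w => h (fst w) (snd w)) (fun z => pair M (f z) (g z))

theorem DeltaPred.comp₂ (P : M.Num → M.Num → Prop) (f g : M.Num → M.Num)
    [DeltaPred fun w => P (fst w) (snd w)] [DeltaFun f] [DeltaFun g] :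
    DeltaPred fun z => P (f z) (g z) := by
  simpa using DeltaPred.comp (fun w => P (fst w) (snd w)) (fun z => pair M (f z) (g z))

instance DeltaFun.ite (P : M.Num → Prop) (f g : M.Num → M.Num) [DeltaPred P] [DeltaFun f]
    [DeltaFun g] [DecidablePred P] : DeltaFun fun z => if P z then f z else g z := by
  have : DeltaPred fun w : M.Num => P (fst w) := .comp P _
  have : DeltaFun fun w : M.Num => f (fst w) := .comp f _
  have : DeltaFun fun w : M.Num => g (fst w) := .comp g _
  refine ⟨?_⟩
  convert DeltaPred.mem (P := fun w : M.Num =>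
    (P (fst w) ∧ snd w = f (fst w)) ∨
    (¬ P (fst w) ∧ snd w = g (fst w))) using 3 with w
  split_ifs with h <;> simp [h]

end Arithmetic

section Recursion

variable {M : L2Structure.{u}} [hM : Fact (IsModelRCA0 M)]

/-! ### Codes of finite sets -/

instance DeltaPred.dvd (f g : M.Num → M.Num) [DeltaFun f] [DeltaFun g] :
    DeltaPred fun z => f z ∣ g z := by
  have h (a b : M.Num) : a ∣ b ↔ ∃ d, d < b + 1 ∧ b = a * d := by
    refine ⟨fun ⟨d, hd⟩ => ?_, fun ⟨d, _, hd⟩ => ⟨d, hd⟩⟩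
    rcases num_eq_zero_or_succ a with rfl | ⟨c, rfl⟩
    · exact ⟨0, by simp, by simpa using hd⟩
    · refine ⟨d, num_lt_add_one_iff.2 ?_, hd⟩
      rw [hd, add_mul, one_mul]
      exact le_add_self
  simp only [h]
  have hf := DeltaFun.comp f
  have hg := DeltaFun.comp g
  infer_instance

theorem num_dvd_of_dvd_add {a x y : M.Num} (hx : a ∣ x) (h : a ∣ x + y) : a ∣ y := by
  obtain ⟨p, rfl⟩ := hx
  obtain ⟨q, hq⟩ := h
  rcases le_total p q with h | h
  · obtain ⟨t, rfl⟩ := exists_add_of_le h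
    exact ⟨t, add_left_cancel (hq.trans (mul_add _ _ _))⟩
  · obtain ⟨t, rfl⟩ := exists_add_of_le h
    rw [mul_add, add_assoc] at hq
    have : a * t + y = 0 := add_left_cancel (hq.trans (add_zero _).symm)
    rw [(add_eq_zero.1 this).2]
    exact dvd_zero a

/-- The moduli `(i + 1) m + 1` and `(l + 1) m + 1` are relatively prime if `m` is a multiple of the
difference of `i` and `l`. -/
theorem dvd_of_dvd_mul_of_coprime {i l m n : M.Num} (hil : i ≠ l)
    (hm : ∀ e, i = l + e + 1 ∨ l = i + e + 1 → e + 1 ∣ m)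
    (h : (i + 1) * m + 1 ∣ n * ((l + 1) * m + 1)) : (i + 1) * m + 1 ∣ n := by
  -- The difference of `(l + 1) ((i + 1) m + 1)` and `(i + 1) ((l + 1) m + 1)` is `l - i`, a divisor
  -- of `m`, which is prime to `(i + 1) m + 1`.
  suffices H : ∃ e, e + 1 ∣ m ∧ (i + 1) * m + 1 ∣ n * (e + 1) by
    obtain ⟨e, ⟨s, hs⟩, h⟩ := H
    refine num_dvd_of_dvd_add (x := n * (e + 1) * (s * (i + 1))) (h.mul_right _) ⟨n, ?_⟩
    calc n * (e + 1) * (s * (i + 1)) + n = n * (((e + 1) * s) * (i + 1)) + n := by ring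
      _ = _ := by rw [← hs]; ring
  rcases lt_or_gt_of_ne hil with h' | h'
  · obtain ⟨e, rfl⟩ := (num_lt_iff _ _).1 h'
    refine ⟨e, hm e (Or.inr rfl), num_dvd_of_dvd_add (h.mul_left (i + 1)) ⟨(i + e + 1 + 1) * n, ?_⟩⟩
    ring
  · obtain ⟨e, rfl⟩ := (num_lt_iff _ _).1 h'
    refine ⟨e, hm e (Or.inl rfl), num_dvd_of_dvd_add
      (x := (l + 1) * n * ((l + e + 1 + 1) * m + 1)) (Dvd.intro_left _ rfl) ?_⟩
    have := h.mul_left (l + e + 1 + 1)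
    convert this using 1
    ring

theorem exists_common_multiple (k : M.Num) : ∃ m : M.Num, 0 < m ∧ ∀ i, i < k → i + 1 ∣ m := by
  refine sigma_induction (fun k m => 0 < m ∧ ∀ i, i < k → i + 1 ∣ m)
    ⟨1, zero_lt_one, fun i hi => (not_lt_zero hi).elim⟩ ?_ k
  rintro k ⟨m, hm, h⟩
  refine ⟨m * (k + 1), mul_pos hm (num_lt_add_one_iff.2 zero_le), fun i hi => ?_⟩
  rcases (num_lt_add_one_iff.1 hi).lt_or_eq with hi | rfl
  exacts [(h i hi).mul_right _, Dvd.intro_left _ rfl]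

theorem inFinite_iff {c i : M.Num} :
    InFinite M c i ↔ i < fst (fst c) ∧ (i + 1) * snd (fst c) + 1 ∣ snd c := by
  constructor
  · rintro ⟨k, m, n, rfl, h, h'⟩
    simpa using ⟨h, h'⟩
  · rintro ⟨h, h'⟩
    exact ⟨_, _, _, by simp, h, h'⟩

instance DeltaPred.inFinite (f g : M.Num → M.Num) [DeltaFun f] [DeltaFun g] :
    DeltaPred fun z => InFinite M (f z) (g z) := by
  simp only [inFinite_iff]
  infer_instance

instance DeltaPred.inFinite_left (c : M.Num) : DeltaPred (InFinite M c) :=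
  .inFinite (fun _ => c) fun z => z

/-- Every bounded set that exists has a code: the initial segments of a set are built up by
multiplying moduli that are relatively prime. -/
theorem exists_finite_code (P : M.Num → Prop) (k : M.Num) (_ : DeltaPred P := by infer_instance) :
    ∃ c, ∀ i, InFinite M c i ↔ i < k ∧ P i := by
  obtain ⟨m, hm, hdvd⟩ := exists_common_multiple k
  have hP := DeltaPred.comp P
  obtain ⟨n, hn⟩ : ∃ n, ∀ i, i < k → ((i + 1) * m + 1 ∣ n ↔ (P i ∧ i < k)) := by
    refine sigma_induction (fun l n => ∀ i, i < k → ((i + 1) * m + 1 ∣ n ↔ (P i ∧ i < l)))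
      ⟨1, fun i _ => iff_of_false ?_ fun h => not_lt_zero h.2⟩ ?_ k
    · rintro ⟨d, hd⟩
      have hd0 : 0 < d := pos_iff_ne_zero.2 (by rintro rfl; simp at hd)
      have h1 : 1 < (i + 1) * m + 1 := by
        rw [num_lt_add_one_iff]
        exact num_add_one_le_iff.2 (mul_pos (num_lt_add_one_iff.2 zero_le) hm) |>.trans' (by simp)
      have h2 : 1 ≤ d := by simpa using num_add_one_le_iff.2 hd0
      exact (h1.trans_le (le_mul_of_one_le_right zero_le h2)).ne hd
    · rintro l ⟨n, hn⟩
      by_cases hl : l < k ∧ P l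
      · refine ⟨n * ((l + 1) * m + 1), fun i hi => ?_⟩
        by_cases hil : i = l
        · subst hil
          exact iff_of_true (Dvd.intro_left _ rfl) ⟨hl.2, num_lt_add_one i⟩
        · rw [num_lt_add_one_iff, le_iff_lt_or_eq, or_iff_left hil, ← hn i hi]
          refine ⟨fun h => dvd_of_dvd_mul_of_coprime hil (fun e he => hdvd e ?_) h,
            fun h => h.mul_right _⟩
          rcases he with rfl | rfl
          · exact (num_lt_add_one_iff.2 le_add_self).trans hi
          · exact (num_lt_add_one_iff.2 le_add_self).trans hl.1
      · refine ⟨n, fun i hi => (hn i hi).trans (and_congr_right fun hP => ?_)⟩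
        rw [num_lt_add_one_iff, le_iff_lt_or_eq, or_iff_left]
        rintro rfl
        exact hl ⟨hi, hP⟩
  refine ⟨pair M (pair M k m) n, fun i => ?_⟩
  simp only [inFinite_iff, fst_pair, snd_pair]
  exact and_congr_right fun hi => (hn i hi).trans (and_iff_left hi)

/-! ### Definition by recursion -/

/-- Recursion along a function `par` that takes a number to a smaller one, unless the number is a
starting point; there the value is given by `b`. A value is witnessed by a finite set of pairs
`(z, g z)` that is closed under the passage from `z` to `par z`. -/
theorem exists_recursion (par b : M.Num → M.Num) (h : M.Num → M.Num → M.Num)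
    (_ : DeltaFun par := by infer_instance) (_ : DeltaFun b := by infer_instance)
    (_ : DeltaFun fun w => h (fst w) (snd w) := by infer_instance) :
    ∃ g : M.Num → M.Num, DeltaFun g ∧ (∀ z, par z < z → g z = h z (g (par z))) ∧
      ∀ z, ¬ par z < z → g z = b z := by
  have hpar := DeltaFun.comp par
  have hb := DeltaFun.comp b
  have hh := DeltaFun.comp₂ h
  let Valid (s : M.Num) : Prop := ∀ w, w < fst (fst s) → InFinite M s w →
    (par (fst w) < fst w ∧ ∃ y, y < fst (fst s) ∧ InFinite M s (pair M (par (fst w)) y) ∧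
      snd w = h (fst w) y) ∨ (¬ par (fst w) < fst w ∧ snd w = b (fst w))
  have valid_comp (f : M.Num → M.Num) [DeltaFun f] : DeltaPred fun z => Valid (f z) :=
    have hf := DeltaFun.comp f
    inferInstanceAs (DeltaPred fun z => ∀ w, w < fst (fst (f z)) → InFinite M (f z) w →
      (par (fst w) < fst w ∧ ∃ y, y < fst (fst (f z)) ∧ InFinite M (f z) (pair M (par (fst w)) y) ∧
      snd w = h (fst w) y) ∨ (¬ par (fst w) < fst w ∧ snd w = b (fst w)))
  have bound {s z y : M.Num} (hs : InFinite M s (pair M z y)) : y < fst (fst s) :=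
    (le_pair_right z y).trans_lt (inFinite_iff.1 hs).1
  have valid_iff (s : M.Num) : Valid s ↔ ∀ z y, InFinite M s (pair M z y) →
      (par z < z ∧ ∃ y', InFinite M s (pair M (par z) y') ∧ y = h z y') ∨
      (¬ par z < z ∧ y = b z) := by
    constructor
    · intro hs z y hzy
      refine (hs _ (inFinite_iff.1 hzy).1 hzy).imp ?_ ?_
      · simp only [fst_pair, snd_pair]
        exact fun ⟨h₁, y', _, h₂, h₃⟩ => ⟨h₁, y', h₂, h₃⟩
      · simp
    · intro hs w _ hw
      refine (hs (fst w) (snd w) (by simpa)).imp_left ?_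
      exact fun ⟨h₁, y', h₂, h₃⟩ => ⟨h₁, y', bound h₂, h₂, h₃⟩
  have uniq (s s' : M.Num) (hs : Valid s) (hs' : Valid s') (z : M.Num) :
      ∀ y, y < fst (fst s) → ∀ y', y' < fst (fst s') → InFinite M s (pair M z y) →
        InFinite M s' (pair M z y') → y = y' := by
    refine delta_strong_induction (fun z => ∀ y, y < fst (fst s) → ∀ y', y' < fst (fst s') →
      InFinite M s (pair M z y) → InFinite M s' (pair M z y') → y = y') (fun z ih => ?_) z
    intro y _ y' _ hy hy'
    rcases (valid_iff s).1 hs z y hy with ⟨h₁, t, ht, rfl⟩ | ⟨h₁, rfl⟩ <;>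
    rcases (valid_iff s').1 hs' z y' hy' with ⟨h₂, t', ht', rfl⟩ | ⟨h₂, rfl⟩
    · rw [ih _ h₁ t (bound ht) t' (bound ht') ht ht']
    · exact absurd h₁ h₂
    · exact absurd h₂ h₁
    · rfl
  have total (n : M.Num) : ∃ s, Valid s ∧ ∀ z, z < n → ∃ y, y < fst (fst s) ∧
      InFinite M s (pair M z y) := by
    refine sigma_induction (fun n s => Valid s ∧ ∀ z, z < n → ∃ y, y < fst (fst s) ∧
      InFinite M s (pair M z y)) ?_ ?_ n
    · obtain ⟨c, hc⟩ := exists_finite_code (fun _ : M.Num => (0 : M.Num) = 0) 0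
      refine ⟨c, (valid_iff c).2 fun z y hzy => ?_, fun z hz => (not_lt_zero hz).elim⟩
      exact (not_lt_zero ((hc _).1 hzy).1).elim
    · rintro n ⟨s, hs, hn⟩
      obtain ⟨v, hv⟩ : ∃ v, (par n < n ∧ ∃ y', InFinite M s (pair M (par n) y') ∧ v = h n y') ∨
          (¬ par n < n ∧ v = b n) := by
        by_cases hp : par n < n
        · obtain ⟨y, _, hy⟩ := hn _ hp
          exact ⟨h n y, Or.inl ⟨hp, y, hy, rfl⟩⟩
        · exact ⟨b n, Or.inr ⟨hp, rfl⟩⟩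
      -- The computation `s` of the values below `n` is continued by the value `v` at `n`.
      obtain ⟨c, hc⟩ := exists_finite_code (fun w => InFinite M s w ∨ w = pair M n v)
        (fst (fst s) + pair M n v + 1)
      have hc (w : M.Num) : InFinite M c w ↔ InFinite M s w ∨ w = pair M n v := by
        refine (hc w).trans (and_iff_right_of_imp ?_)
        rintro (hw | rfl)
        · exact num_lt_add_one_iff.2 ((inFinite_iff.1 hw).1.le.trans le_self_add)
        · exact num_lt_add_one_iff.2 le_add_self
      have mono {w : M.Num} (hw : InFinite M s w) : InFinite M c w := (hc w).2 (Or.inl hw)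
      refine ⟨c, (valid_iff c).2 fun z y hzy => ?_, fun z hz => ?_⟩
      · rcases (hc _).1 hzy with hzy | hzy
        · exact ((valid_iff s).1 hs z y hzy).imp_left
            fun ⟨h₁, y', h₂, h₃⟩ => ⟨h₁, y', mono h₂, h₃⟩
        · obtain ⟨rfl, rfl⟩ := pair_inj.1 hzy
          exact hv.imp_left fun ⟨h₁, y', h₂, h₃⟩ => ⟨h₁, y', mono h₂, h₃⟩
      · rcases (num_lt_add_one_iff.1 hz).lt_or_eq with hz | rfl
        · obtain ⟨y, _, hy⟩ := hn z hz
          exact ⟨y, bound (mono hy), mono hy⟩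
        · have := (hc _).2 (Or.inr rfl)
          exact ⟨v, bound this, this⟩
  have ex (z : M.Num) : ∃ y s, Valid s ∧ InFinite M s (pair M z y) := by
    obtain ⟨s, hs, h⟩ := total (z + 1)
    obtain ⟨y, _, hy⟩ := h z (num_lt_add_one z)
    exact ⟨y, s, hs, hy⟩
  choose g s hs hg using ex
  have eq_g {z y s' : M.Num} (hs' : Valid s') (hy : InFinite M s' (pair M z y)) : y = g z :=
    uniq _ _ hs' (hs z) z y (bound hy) _ (bound (hg z)) hy (hg z)
  -- The graph of `g` is `Σ⁰₁`, as the values are unique.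
  refine ⟨g, .of_sigma_graph g (fun z y s => Valid s ∧ InFinite M s (pair M z y))
    fun z y => ⟨?_, fun ⟨s', hs', hy⟩ => eq_g hs' hy⟩, fun z hz => ?_, fun z hz => ?_⟩
  · rintro rfl
    exact ⟨s z, hs z, hg z⟩
  · rcases (valid_iff _).1 (hs z) z _ (hg z) with ⟨_, y, hy, h'⟩ | ⟨h', _⟩
    · rw [h', eq_g (hs z) hy]
    · exact absurd hz h'
  · rcases (valid_iff _).1 (hs z) z _ (hg z) with ⟨h', _⟩ | ⟨_, h'⟩
    exacts [absurd h' hz, h']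

theorem exists_predecessor :
    ∃ p : M.Num → M.Num, DeltaFun p ∧ p 0 = 0 ∧ ∀ n, p (n + 1) = n := by
  obtain ⟨p, hp, h⟩ := exists_search (fun x y : M.Num => (x = 0 ∧ y = 0) ∨ x = y + 1) fun x => by
    rcases num_eq_zero_or_succ x with rfl | ⟨m, rfl⟩
    exacts [⟨0, Or.inl ⟨rfl, rfl⟩⟩, ⟨m, Or.inr rfl⟩]
  refine ⟨p, hp, ?_, fun n => ?_⟩
  · exact (h 0).elim And.right fun h => (hM.out.succ_ne_zero _ h.symm).elim
  · exact (h (n + 1)).elim (fun h => (hM.out.succ_ne_zero _ h.1).elim)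
      fun h => (add_right_cancel h).symm

theorem exists_primitive_recursion (a : M.Num) (h : M.Num → M.Num → M.Num)
    (_ : DeltaFun fun w => h (fst w) (snd w) := by infer_instance) :
    ∃ g : M.Num → M.Num, DeltaFun g ∧ g 0 = a ∧ ∀ n, g (n + 1) = h n (g n) := by
  obtain ⟨p, hp, hp0, hps⟩ := exists_predecessor (M := M)
  have hp' := DeltaFun.comp p
  have hh := DeltaFun.comp₂ h
  obtain ⟨g, hg, h₁, h₂⟩ := exists_recursion p (fun _ => a) (fun n y => h (p n) y)
  refine ⟨g, hg, h₂ 0 not_lt_zero, fun n => ?_⟩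
  rw [h₁ _ (by rw [hps]; exact num_lt_add_one n), hps]

end Recursion

section BinaryStrings

variable {M : L2Structure.{u}} [hM : Fact (IsModelRCA0 M)]

/-! ### Binary strings -/

theorem num_add_self_inj {a b : M.Num} : a + a = b + b ↔ a = b := by
  refine ⟨fun h => ?_, fun h => by rw [h]⟩
  rcases lt_trichotomy a b with h' | h' | h'
  exacts [absurd h (add_lt_add h' h').ne, h', absurd h (add_lt_add h' h').ne']

theorem num_add_self_add_one_ne (a b : M.Num) : a + a + 1 ≠ b + b := by
  intro h
  rcases lt_or_ge a b with h' | h'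
  · have h' := num_add_one_le_iff.2 h'
    have := (num_lt_add_one (a + a + 1)).trans_le
      ((add_le_add h' h').trans' (by rw [add_add_add_comm, ← add_assoc]))
    exact this.ne h
  · exact ((num_lt_add_one _).trans_le' (add_le_add h' h')).ne' h

theorem binary_cases (p : M.Num) : p = 0 ∨ ∃ q, p = snocZero M q ∨ p = snocOne M q := by
  have h := delta_induction
    (fun p : M.Num => p = 0 ∨ ∃ q, q < p ∧ (p = q + q + 1 ∨ p = q + q + 1 + 1)) (Or.inl rfl) ?_ p
  · exact h.imp_right fun ⟨q, _, h⟩ => ⟨q, h⟩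
  · rintro n (rfl | ⟨q, hq, rfl | rfl⟩)
    · exact Or.inr ⟨0, num_lt_add_one 0, Or.inl (by rw [add_zero])⟩
    · exact Or.inr ⟨q, hq.trans (num_lt_add_one _), Or.inr rfl⟩
    · refine Or.inr ⟨q + 1, ?_, Or.inl ?_⟩
      · exact add_lt_add_left hq 1
      · rw [add_add_add_comm, add_assoc (q + q)]

theorem lt_snocZero (p : M.Num) : p < snocZero M p := num_lt_add_one_iff.2 le_self_add

theorem lt_snocOne (p : M.Num) : p < snocOne M p := (lt_snocZero p).trans (num_lt_add_one _)

theorem snocZero_ne_zero (p : M.Num) : snocZero M p ≠ 0 := (zero_le.trans_lt (lt_snocZero p)).ne'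

theorem snocOne_ne_zero (p : M.Num) : snocOne M p ≠ 0 := (zero_le.trans_lt (lt_snocOne p)).ne'

theorem snocZero_ne_snocOne (p q : M.Num) : snocZero M p ≠ snocOne M q := fun h =>
  num_add_self_add_one_ne q p (add_right_cancel h).symm

theorem snocZero_inj {p q : M.Num} : snocZero M p = snocZero M q ↔ p = q :=
  add_left_inj (1 : M.Num) |>.trans num_add_self_inj

theorem snocOne_inj {p q : M.Num} : snocOne M p = snocOne M q ↔ p = q :=
  add_left_inj (1 : M.Num) |>.trans snocZero_inj

instance DeltaFun.snocZero_comp (f : M.Num → M.Num) [DeltaFun f] :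
    DeltaFun fun z => snocZero M (f z) :=
  inferInstanceAs (DeltaFun fun z => f z + f z + 1)

instance DeltaFun.snocOne_comp (f : M.Num → M.Num) [DeltaFun f] :
    DeltaFun fun z => snocOne M (f z) :=
  inferInstanceAs (DeltaFun fun z => f z + f z + 1 + 1)

theorem binary_induction (P : M.Num → Prop) (zero : P 0)
    (succ : ∀ p, P p → P (snocZero M p) ∧ P (snocOne M p)) (p : M.Num)
    (_ : DeltaPred P := by infer_instance) : P p := by
  refine delta_strong_induction P (fun n ih => ?_) p
  rcases binary_cases n with rfl | ⟨q, rfl | rfl⟩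
  exacts [zero, (succ q (ih q (lt_snocZero q))).1, (succ q (ih q (lt_snocOne q))).2]

theorem exists_binParent : ∃ f : M.Num → M.Num, DeltaFun f ∧
    ∀ p, (p = 0 ∧ f p = 0) ∨ p = snocZero M (f p) ∨ p = snocOne M (f p) :=
  exists_search (fun p q : M.Num => (p = 0 ∧ q = 0) ∨ p = snocZero M q ∨ p = snocOne M q)
    fun p => by
      rcases binary_cases p with rfl | ⟨q, h⟩
      exacts [⟨0, Or.inl ⟨rfl, rfl⟩⟩, ⟨q, Or.inr h⟩]

/-- The binary string `p` without its last entry. -/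
noncomputable def binParent (p : M.Num) : M.Num := exists_binParent.choose p

instance DeltaFun.binParent_fun : DeltaFun (binParent : M.Num → M.Num) :=
  exists_binParent.choose_spec.1

instance DeltaFun.binParent_comp (f : M.Num → M.Num) [DeltaFun f] :
    DeltaFun fun z => binParent (f z) :=
  .comp _ f

theorem eq_snoc_binParent {p : M.Num} (hp : p ≠ 0) :
    p = snocZero M (binParent p) ∨ p = snocOne M (binParent p) :=
  ((exists_binParent (M := M)).choose_spec.2 p).resolve_left fun h => hp h.1

@[simp] theorem binParent_snocZero (p : M.Num) : binParent (snocZero M p) = p := by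
  rcases eq_snoc_binParent (snocZero_ne_zero p) with h | h
  exacts [(snocZero_inj.1 h).symm, (snocZero_ne_snocOne _ _ h).elim]

@[simp] theorem binParent_snocOne (p : M.Num) : binParent (snocOne M p) = p := by
  rcases eq_snoc_binParent (snocOne_ne_zero p) with h | h
  exacts [(snocZero_ne_snocOne _ _ h.symm).elim, (snocOne_inj.1 h).symm]

theorem binParent_lt {p : M.Num} (hp : p ≠ 0) : binParent p < p := by
  rcases eq_snoc_binParent hp with h | h
  · exact (lt_snocZero _).trans_eq h.symm
  · exact (lt_snocOne _).trans_eq h.symm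

theorem exists_binLength : ∃ f : M.Num → M.Num, DeltaFun f ∧ f 0 = 0 ∧
    ∀ p, p ≠ 0 → f p = f (binParent p) + 1 := by
  obtain ⟨f, hf, h₁, h₂⟩ := exists_recursion (M := M) binParent (fun _ => 0)
    (fun _ y => y + 1)
  exact ⟨f, hf, h₂ 0 not_lt_zero, fun p hp => h₁ p (binParent_lt hp)⟩

/-- The length of the binary string `p`. -/
noncomputable def binLength (p : M.Num) : M.Num := exists_binLength.choose p

instance DeltaFun.binLength_fun : DeltaFun (binLength : M.Num → M.Num) :=
  exists_binLength.choose_spec.1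

instance DeltaFun.binLength_comp (f : M.Num → M.Num) [DeltaFun f] :
    DeltaFun fun z => binLength (f z) :=
  .comp _ f

@[simp] theorem binLength_zero : binLength (0 : M.Num) = 0 := exists_binLength.choose_spec.2.1

theorem binLength_eq_succ {p : M.Num} (hp : p ≠ 0) : binLength p = binLength (binParent p) + 1 :=
  exists_binLength.choose_spec.2.2 p hp

@[simp] theorem binLength_snocZero (p : M.Num) : binLength (snocZero M p) = binLength p + 1 := by
  rw [binLength_eq_succ (snocZero_ne_zero p), binParent_snocZero]

@[simp] theorem binLength_snocOne (p : M.Num) : binLength (snocOne M p) = binLength p + 1 := by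
  rw [binLength_eq_succ (snocOne_ne_zero p), binParent_snocOne]

theorem exists_truncate : ∃ f : M.Num → M.Num → M.Num, DeltaFun (fun w => f (fst w) (snd w)) ∧
    (∀ p n, binLength p ≤ n → f p n = p) ∧
    ∀ p n, ¬ binLength p ≤ n → f p n = f (binParent p) n := by
  classical
  obtain ⟨f, hf, h₁, h₂⟩ := exists_recursion (M := M)
    (fun z => if binLength (snd z) ≤ fst z then z else pair M (fst z) (binParent (snd z)))
    (fun z => snd z) (fun _ y => y)
  refine ⟨fun p n => f (pair M n p), .comp f _, fun p n h => ?_, fun p n h => ?_⟩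
  · simpa [h] using h₂ (pair M n p)
  · have hp : p ≠ 0 := by
      rintro rfl
      exact h (by simp)
    simpa [h] using h₁ (pair M n p) (by simpa [h] using pair_lt_pair_right n (binParent_lt hp))

/-- The initial segment of length `n` of the binary string `p`, which is `p` itself if `p` is
shorter. -/
noncomputable def truncate (p n : M.Num) : M.Num := exists_truncate.choose p n

instance DeltaFun.truncate_comp (f g : M.Num → M.Num) [DeltaFun f] [DeltaFun g] :
    DeltaFun fun z => truncate (f z) (g z) :=
  haveI := (exists_truncate (M := M)).choose_spec.1
  .comp₂ (exists_truncate (M := M)).choose f g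

theorem truncate_of_le {p n : M.Num} (h : binLength p ≤ n) : truncate p n = p :=
  exists_truncate.choose_spec.2.1 p n h

theorem truncate_of_lt {p n : M.Num} (h : n < binLength p) :
    truncate p n = truncate (binParent p) n :=
  exists_truncate.choose_spec.2.2 p n (not_le.2 h)

theorem truncate_snocZero {p n : M.Num} (h : n ≤ binLength p) :
    truncate (snocZero M p) n = truncate p n := by
  rw [truncate_of_lt (by simpa [num_lt_add_one_iff]), binParent_snocZero]

theorem truncate_snocOne {p n : M.Num} (h : n ≤ binLength p) :
    truncate (snocOne M p) n = truncate p n := by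
  rw [truncate_of_lt (by simpa [num_lt_add_one_iff]), binParent_snocOne]

/-- The length, the parent and the size of `truncate p n`, by one induction on `p`. -/
theorem binLength_truncate_and_binParent_truncate (p n : M.Num) :
    (n ≤ binLength p → binLength (truncate p n) = n) ∧
      (n < binLength p → binParent (truncate p (n + 1)) = truncate p n) ∧ truncate p n ≤ p := by
  refine binary_induction (fun p => (n ≤ binLength p → binLength (truncate p n) = n) ∧
      (n < binLength p → binParent (truncate p (n + 1)) = truncate p n) ∧ truncate p n ≤ p)
      ⟨fun h => ?_, fun h => ?_, ?_⟩ (fun q hq => ?_) p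
  · rw [truncate_of_le (by simp)]
    exact (h.antisymm (by simp)).symm
  · exact (not_lt_zero (h.trans_eq binLength_zero)).elim
  · rw [truncate_of_le (by simp)]
  · -- Both extensions `s` of `q` are treated alike.
    have key (s : M.Num) (hs : s ≠ 0) (hqs : binParent s = q) :
        (n ≤ binLength s → binLength (truncate s n) = n) ∧
          (n < binLength s → binParent (truncate s (n + 1)) = truncate s n) ∧
          truncate s n ≤ s := by
      have hl := binLength_eq_succ hs
      rw [hqs] at hl
      rcases lt_trichotomy n (binLength s) with h | h | h
      · have hn : n ≤ binLength q := num_lt_add_one_iff.1 (h.trans_eq hl)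
        rw [truncate_of_lt h, hqs]
        refine ⟨fun _ => hq.1 hn, fun _ => ?_, hq.2.2.trans (hqs ▸ (binParent_lt hs).le)⟩
        rcases hn.lt_or_eq with hn | hn
        · rw [truncate_of_lt (by rw [hl]; exact add_lt_add_left hn 1), hqs, hq.2.1 hn]
        · rw [truncate_of_le (by rw [hl, hn]), truncate_of_le hn.ge, hqs]
      · rw [truncate_of_le h.ge]
        exact ⟨fun _ => h.symm, fun h' => (h'.ne h).elim, le_rfl⟩
      · rw [truncate_of_le h.le]
        exact ⟨fun h' => (h'.not_gt h).elim, fun h' => (h'.not_gt h).elim, le_rfl⟩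
    exact ⟨key _ (snocZero_ne_zero q) (by simp),
      key _ (snocOne_ne_zero q) (by simp)⟩

theorem binLength_truncate {p n : M.Num} (h : n ≤ binLength p) : binLength (truncate p n) = n :=
  (binLength_truncate_and_binParent_truncate p n).1 h

theorem binParent_truncate {p n : M.Num} (h : n < binLength p) :
    binParent (truncate p (n + 1)) = truncate p n :=
  (binLength_truncate_and_binParent_truncate p n).2.1 h

theorem truncate_le (p n : M.Num) : truncate p n ≤ p :=
  (binLength_truncate_and_binParent_truncate p n).2.2

theorem truncate_truncate (p : M.Num) {m n : M.Num} (h : m ≤ n) :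
    truncate (truncate p n) m = truncate p m := by
  refine delta_strong_induction (fun p => truncate (truncate p n) m = truncate p m)
    (fun p ih => ?_) p
  rcases le_or_gt (binLength p) n with hp | hp
  · rw [truncate_of_le hp]
  · have h0 : p ≠ 0 := by
      rintro rfl
      exact not_lt_zero (hp.trans_eq binLength_zero)
    rw [truncate_of_lt hp, truncate_of_lt (h.trans_lt hp), ih _ (binParent_lt h0)]

/-- The binary string `p` is an initial segment of the binary string `q`. -/
def IsInitial (p q : M.Num) : Prop := truncate q (binLength p) = p

instance DeltaPred.isInitial_comp (f g : M.Num → M.Num) [DeltaFun f] [DeltaFun g] :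
    DeltaPred fun z => IsInitial (f z) (g z) :=
  inferInstanceAs (DeltaPred fun z => truncate (g z) (binLength (f z)) = f z)

theorem IsInitial.le {p q : M.Num} (h : IsInitial p q) : p ≤ q :=
  h.symm.trans_le (truncate_le q (binLength p))

theorem IsInitial.binLength_le {p q : M.Num} (h : IsInitial p q) : binLength p ≤ binLength q := by
  by_contra h'
  have := truncate_of_le (not_le.1 h').le
  rw [h] at this
  exact h' (by rw [this])

theorem IsInitial.trans {p q s : M.Num} (h : IsInitial p q) (h' : IsInitial q s) :
    IsInitial p s := by
  have := truncate_truncate s h.binLength_le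
  rw [h', h] at this
  exact this.symm

/-! ### Initial segments of a set -/

/-- The function `r` takes `n` to the binary string `X(0) X(1) ⋯ X(n - 1)`. -/
def InitialSegments (X : Set M.Num) (r : M.Num → M.Num) : Prop :=
  r 0 = 0 ∧ ∀ n, (n ∈ X → r (n + 1) = snocOne M (r n)) ∧ (n ∉ X → r (n + 1) = snocZero M (r n))

theorem InitialSegments.succ_eq {N : L2Structure.{u}} {X : Set N.Num} {r : N.Num → N.Num}
    (h : InitialSegments X r) (n : N.Num) :
    r (n + 1) = snocOne N (r n) ∨ r (n + 1) = snocZero N (r n) := by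
  by_cases hn : n ∈ X
  exacts [Or.inl ((h.2 n).1 hn), Or.inr ((h.2 n).2 hn)]

theorem exists_initialSegments {X : Set M.Num} (hX : X ∈ M.Sets) :
    ∃ r, DeltaFun r ∧ InitialSegments X r := by
  classical
  have := Fact.mk hX
  obtain ⟨r, hr, h0, h⟩ := exists_primitive_recursion (M := M) 0
    (fun n y => if n ∈ X then snocOne M y else snocZero M y)
  exact ⟨r, hr, h0, fun n => ⟨fun hn => by rw [h, if_pos hn], fun hn => by rw [h, if_neg hn]⟩⟩

section InitialSegments

variable {X : Set M.Num} {r : M.Num → M.Num}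

theorem InitialSegments.binLength_eq (h : InitialSegments X r) [DeltaFun r] (n : M.Num) :
    binLength (r n) = n := by
  refine delta_induction (fun n => binLength (r n) = n) (by rw [h.1, binLength_zero])
    (fun n hn => ?_) n
  rcases h.succ_eq n with h | h <;> rw [h] <;> simp [hn]

theorem InitialSegments.truncate_eq (h : InitialSegments X r) [DeltaFun r] {m n : M.Num}
    (hmn : m ≤ n) : truncate (r n) m = r m := by
  have hrc := DeltaFun.comp r
  refine delta_induction (fun n => m ≤ n → truncate (r n) m = r m) (fun hm => ?_)
    (fun n hn hm => ?_) n inferInstance hmn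
  · rw [hm.antisymm zero_le, truncate_of_le (h.binLength_eq 0).le]
  · rcases hm.lt_or_eq with hm | rfl
    · have hm := num_lt_add_one_iff.1 hm
      have hm' := hm.trans_eq (h.binLength_eq n).symm
      rcases h.succ_eq n with h | h
      · rw [h, truncate_snocOne hm', hn hm]
      · rw [h, truncate_snocZero hm', hn hm]
    · exact truncate_of_le (h.binLength_eq _).le

theorem InitialSegments.prefix_iff_exists (h : InitialSegments X r) [hr : DeltaFun r]
    {p : M.Num} : Prefix M p X ↔ ∃ n, r n = p := by
  constructor
  · rintro ⟨g, hg, ⟨hfun, h0, hs⟩, n, hn⟩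
    have := Fact.mk hg
    refine ⟨n, (hfun n).unique ?_ hn⟩
    refine delta_induction (fun n => pair M n (r n) ∈ g) (by rwa [h.1]) (fun n hn => ?_) n
    by_cases hX : n ∈ X
    · rw [(h.2 n).1 hX]
      exact (hs _ _ hn).1 hX
    · rw [(h.2 n).2 hX]
      exact (hs _ _ hn).2 hX
  · rintro ⟨n, rfl⟩
    refine ⟨_, hr.mem, ⟨fun n => ⟨r n, by simp, fun y hy => by simpa using hy⟩, by simp [h.1],
      fun n p hp => ?_⟩, n, by simp⟩
    rw [DeltaFun.pair_mem_iff] at hp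
    subst hp
    simp only [DeltaFun.pair_mem_iff]
    exact ⟨fun hn => ((h.2 n).1 hn).symm, fun hn => ((h.2 n).2 hn).symm⟩

theorem InitialSegments.prefix_iff (h : InitialSegments X r) [DeltaFun r] {p : M.Num} :
    Prefix M p X ↔ r (binLength p) = p := by
  rw [h.prefix_iff_exists]
  refine ⟨?_, fun h => ⟨_, h⟩⟩
  rintro ⟨n, rfl⟩
  rw [h.binLength_eq]

end InitialSegments

theorem Prefix.isInitial {p q : M.Num} {X : Set M.Num} (hX : X ∈ M.Sets) (hp : Prefix M p X)
    (hq : Prefix M q X) (h : binLength p ≤ binLength q) : IsInitial p q := by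
  obtain ⟨r, _, hr⟩ := exists_initialSegments hX
  rw [hr.prefix_iff] at hp hq
  rw [IsInitial, ← hq, hr.truncate_eq h, hp]

theorem Prefix.of_isInitial {p q : M.Num} {X : Set M.Num} (hX : X ∈ M.Sets) (hq : Prefix M q X)
    (h : IsInitial p q) : Prefix M p X := by
  obtain ⟨r, _, hr⟩ := exists_initialSegments hX
  rw [hr.prefix_iff] at hq ⊢
  rw [← hr.truncate_eq h.binLength_le, hq, h]

/-- An increasing sequence of longer and longer strings has a limit. -/
theorem exists_limit_of_strings (P : M.Num → M.Num) [DeltaFun P]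
    (hP : ∀ n, IsInitial (P n) (P (n + 1))) (hl : ∀ n, n ≤ binLength (P n)) :
    ∃ X ∈ M.Sets, ∀ n, Prefix M (P n) X := by
  have hPc := DeltaFun.comp P
  -- The initial segment of length `n` of the limit can be read off from `P n`.
  let r (n : M.Num) : M.Num := truncate (P n) n
  have hr : DeltaFun r := inferInstanceAs (DeltaFun fun n => truncate (P n) n)
  have hrc := DeltaFun.comp r
  have hX : DeltaPred fun n => r (n + 1) = snocOne M (r n) := inferInstance
  have hseg : InitialSegments {n | r (n + 1) = snocOne M (r n)} r := by
    refine ⟨?_, fun n => ⟨id, fun hn => ?_⟩⟩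
    · have := truncate_truncate (P 0) (le_refl (0 : M.Num))
      have h0 := binLength_truncate (zero_le (a := binLength (P 0)))
      by_contra hne
      rw [binLength_eq_succ hne] at h0
      exact hM.out.succ_ne_zero _ h0
    · have hlen : binLength (r (n + 1)) = n + 1 := binLength_truncate (hl (n + 1))
      have hne : r (n + 1) ≠ 0 := by
        intro h
        rw [h, binLength_zero] at hlen
        exact hM.out.succ_ne_zero _ hlen.symm
      have hpar : binParent (r (n + 1)) = r n := by
        have h₁ := binParent_truncate (num_add_one_le_iff.1 (hl (n + 1)))
        have h₂ := truncate_truncate (P (n + 1)) (hl n)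
        rw [hP n] at h₂
        exact h₁.trans h₂.symm
      have := eq_snoc_binParent hne
      rw [hpar] at this
      exact this.resolve_right hn
  refine ⟨_, hX.mem, fun k => hseg.prefix_iff.2 ?_⟩
  have hmono (l : M.Num) : k ≤ l → IsInitial (P k) (P l) := by
    refine delta_induction (fun l => k ≤ l → IsInitial (P k) (P l)) (fun h => ?_)
      (fun l ih h => ?_) l
    · rw [h.antisymm zero_le]
      exact truncate_of_le le_rfl
    · rcases h.lt_or_eq with h | rfl
      · exact (ih (num_lt_add_one_iff.1 h)).trans (hP l)
      · exact truncate_of_le le_rfl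
  exact hmono _ (hl k)

/-- The Baire category theorem, for the sequence of open sets that is coded by `D`: given a string,
search for a longer one above it that has an initial segment in the next open set, and repeat. -/
theorem exists_generic {D : Set M.Num} (hD : D ∈ M.Sets)
    (hdense : ∀ n, IsDenseIn M fun X => InOpen M (sec M D n) X) (p : M.Num) :
    ∃ X ∈ M.Sets, Prefix M p X ∧ ∀ n, InOpen M (sec M D n) X := by
  have := Fact.mk hD
  obtain ⟨s, hs, hs'⟩ := exists_search (fun z q : M.Num =>
    (IsInitial (snd z) q ∧ binLength (snd z) < binLength q) ∧
      ∃ d, d < q + 1 ∧ pair M (fst z) d ∈ D ∧ IsInitial d q) fun z => by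
    obtain ⟨X, hX, hzX, d, hd, hdX⟩ := hdense (fst z) (snd z)
    obtain ⟨r, _, hr⟩ := exists_initialSegments hX
    have hq (n : M.Num) : Prefix M (r n) X := hr.prefix_iff_exists.2 ⟨n, rfl⟩
    have hdq : IsInitial d (r (binLength (snd z) + binLength d + 1)) :=
      hdX.isInitial hX (hq _) (by rw [hr.binLength_eq]; exact le_add_right le_add_self)
    refine ⟨r (binLength (snd z) + binLength d + 1), ⟨hzX.isInitial hX (hq _) ?_, ?_⟩,
      d, num_lt_add_one_iff.2 hdq.le, hd, hdq⟩
    · rw [hr.binLength_eq, add_assoc]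
      exact le_self_add
    · rw [hr.binLength_eq]
      exact num_lt_add_one_iff.2 le_self_add
  have hsc := DeltaFun.comp s
  obtain ⟨P, hP, hP0, hPs⟩ := exists_primitive_recursion p (fun n y => s (pair M n y))
  have step (n : M.Num) := hs' (pair M n (P n))
  simp only [fst_pair, snd_pair, ← hPs] at step
  have hPc := DeltaFun.comp P
  obtain ⟨X, hX, h⟩ := exists_limit_of_strings P (fun n => (step n).1.1) fun n => by
    refine delta_induction (fun n => n ≤ binLength (P n)) zero_le (fun n hn => ?_) n
    exact num_add_one_le_iff.2 (hn.trans_lt (step n).1.2)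
  refine ⟨X, hX, hP0 ▸ h 0, fun n => ?_⟩
  obtain ⟨-, d, -, hd, hdP⟩ := step n
  exact ⟨d, hd, (h (n + 1)).of_isInitial hX hdP⟩

/-! ### A sequence of incompatible binary strings -/

/-- The strings `0ⁱ1`. -/
theorem exists_marker : ∃ m : M.Num → M.Num, DeltaFun m ∧
    ∀ i j, ∀ X ∈ M.Sets, Prefix M (m i) X → Prefix M (m j) X → i = j := by
  have hempty : DeltaPred fun _ : M.Num => (0 : M.Num) = 1 := inferInstance
  obtain ⟨z, hz, hseg⟩ := exists_initialSegments hempty.mem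
  refine ⟨fun i => snocOne M (z i), inferInstance, ?_⟩
  have key {i j : M.Num} {X : Set M.Num} (hX : X ∈ M.Sets) (hi : Prefix M (snocOne M (z i)) X)
      (hj : Prefix M (snocOne M (z j)) X) : ¬ i < j := by
    intro hij
    obtain ⟨r, _, hr⟩ := exists_initialSegments hX
    rw [hr.prefix_iff, binLength_snocOne, hseg.binLength_eq] at hi hj
    have h₁ : r j = z j := by
      rw [← binParent_snocOne (z j), ← hj]
      rcases hr.succ_eq j with h | h <;> simp [h]
    have h₂ := hr.truncate_eq (num_add_one_le_iff.2 hij)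
    rw [h₁, hseg.truncate_eq (num_add_one_le_iff.2 hij), hi, (hseg.2 i).2] at h₂
    · exact snocZero_ne_snocOne _ _ h₂
    · exact fun h : (0 : M.Num) = 1 => zero_ne_one h
  intro i j X hX hi hj
  rcases lt_trichotomy i j with h | h | h
  exacts [(key hX hi hj h).elim, h, (key hX hj hi h).elim]

end BinaryStrings

section Strings

variable {M : L2Structure.{u}} [hM : Fact (IsModelRCA0 M)]

/-! ### Strings of numbers -/

instance DeltaFun.snoc_comp (f g : M.Num → M.Num) [DeltaFun f] [DeltaFun g] :
    DeltaFun fun z => snoc M (f z) (g z) :=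
  inferInstanceAs (DeltaFun fun z => pair M (f z) (g z) + 1)

theorem snoc_inj {σ τ m n : M.Num} : snoc M σ m = snoc M τ n ↔ σ = τ ∧ m = n :=
  (add_left_inj (1 : M.Num)).trans pair_inj

theorem snoc_ne_zero (σ n : M.Num) : snoc M σ n ≠ 0 := hM.out.succ_ne_zero _

theorem lt_snoc (σ n : M.Num) : σ < snoc M σ n := num_lt_add_one_iff.2 (le_pair_left σ n)

theorem string_cases (σ : M.Num) : σ = 0 ∨ ∃ τ n, σ = snoc M τ n := by
  refine (num_eq_zero_or_succ σ).imp_right fun ⟨p, hp⟩ => ⟨fst p, snd p, ?_⟩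
  rw [hp, snoc, pair_fst_snd]

theorem string_induction (P : M.Num → Prop) (zero : P 0) (snoc : ∀ σ n, P σ → P (snoc M σ n))
    (σ : M.Num) (_ : DeltaPred P := by infer_instance) : P σ := by
  refine delta_strong_induction P (fun σ ih => ?_) σ
  rcases string_cases σ with rfl | ⟨τ, n, rfl⟩
  exacts [zero, snoc τ n (ih τ (lt_snoc τ n))]

theorem exists_prepend : ∃ f : M.Num → M.Num → M.Num, DeltaFun (fun w => f (fst w) (snd w)) ∧
    (∀ i, f i 0 = snoc M 0 i) ∧ ∀ i σ n, f i (snoc M σ n) = snoc M (f i σ) n := by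
  classical
  obtain ⟨p, hp, -, hps⟩ := exists_predecessor (M := M)
  have hpc := DeltaFun.comp p
  obtain ⟨f, hf, h₁, h₂⟩ := exists_recursion (M := M)
    (fun z => if snd z = 0 then z else pair M (fst z) (fst (p (snd z))))
    (fun z => snoc M 0 (fst z)) (fun z y => snoc M y (snd (p (snd z))))
  refine ⟨fun i σ => f (pair M i σ), .comp f _, fun i => ?_, fun i σ n => ?_⟩
  · simpa using h₂ (pair M i 0)
  · have hp : p (snoc M σ n) = pair M σ n := hps _
    simpa [snoc_ne_zero, hp] using h₁ (pair M i (snoc M σ n))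
      (by simpa [snoc_ne_zero, hp] using pair_lt_pair_right i (lt_snoc σ n))

/-- The string with first entry `i` that continues with `σ`. -/
noncomputable def prepend (i σ : M.Num) : M.Num := exists_prepend.choose i σ

instance DeltaFun.prepend_comp (f g : M.Num → M.Num) [DeltaFun f] [DeltaFun g] :
    DeltaFun fun z => prepend (f z) (g z) :=
  haveI := (exists_prepend (M := M)).choose_spec.1
  .comp₂ (exists_prepend (M := M)).choose f g

instance DeltaFun.prepend_left (i : M.Num) : DeltaFun (prepend i) :=
  .prepend_comp (fun _ => i) fun z => z

theorem prepend_zero (i : M.Num) : prepend i 0 = snoc M 0 i := exists_prepend.choose_spec.2.1 i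

theorem prepend_snoc (i σ n : M.Num) : prepend i (snoc M σ n) = snoc M (prepend i σ) n :=
  exists_prepend.choose_spec.2.2 i σ n

theorem prepend_ne_zero (i σ : M.Num) : prepend i σ ≠ 0 := by
  rcases string_cases σ with rfl | ⟨τ, n, rfl⟩
  · rw [prepend_zero]
    exact snoc_ne_zero _ _
  · rw [prepend_snoc]
    exact snoc_ne_zero _ _

theorem pair_le_pair_left {a a' : M.Num} (h : a ≤ a') (b : M.Num) : pair M a b ≤ pair M a' b := by
  unfold pair
  split_ifs with h₁ h₂ h₂
  · gcongr
  · calc b * b + a ≤ a' * a' + a' := by gcongr <;> exact not_lt.1 h₂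
      _ ≤ _ := le_self_add
  · exact (h₁ (h.trans_lt h₂)).elim
  · gcongr

theorem le_prepend (i σ : M.Num) : i ≤ prepend i σ ∧ σ ≤ prepend i σ := by
  refine string_induction (fun σ => i ≤ prepend i σ ∧ σ ≤ prepend i σ) ?_ (fun σ n h => ?_) σ
  · rw [prepend_zero]
    exact ⟨(le_pair_right 0 i).trans (num_lt_add_one _).le, zero_le⟩
  · rw [prepend_snoc]
    exact ⟨h.1.trans (lt_snoc _ _).le, add_le_add_left (pair_le_pair_left h.2 n) 1⟩

theorem prepend_inj {i j σ τ : M.Num} : prepend i σ = prepend j τ ↔ i = j ∧ σ = τ := by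
  refine ⟨fun h => ?_, fun ⟨h, h'⟩ => by rw [h, h']⟩
  refine string_induction
    (fun σ => ∀ τ, τ < prepend i σ + 1 → prepend i σ = prepend j τ → i = j ∧ σ = τ)
    (fun τ _ h => ?_) (fun σ n ih τ _ h => ?_) σ inferInstance τ
    (num_lt_add_one_iff.2 (h ▸ (le_prepend j τ).2)) h
  · rcases string_cases τ with rfl | ⟨τ, k, rfl⟩
    · rw [prepend_zero, prepend_zero, snoc_inj] at h
      exact ⟨h.2, rfl⟩
    · rw [prepend_zero, prepend_snoc, snoc_inj] at h
      exact (prepend_ne_zero _ _ h.1.symm).elim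
  · rcases string_cases τ with rfl | ⟨τ, k, rfl⟩
    · rw [prepend_zero, prepend_snoc, snoc_inj] at h
      exact (prepend_ne_zero _ _ h.1).elim
    · rw [prepend_snoc, prepend_snoc, snoc_inj] at h
      obtain ⟨h, rfl⟩ := h
      obtain ⟨rfl, rfl⟩ := ih τ (num_lt_add_one_iff.2 (h ▸ (le_prepend j τ).2)) h
      exact ⟨rfl, rfl⟩

/-! ### Well-founded trees and uniqueness of evaluation maps -/

/-- Paths as functions instead of graphs. -/
theorem isWellFounded_iff {T : Set M.Num} : IsWellFounded M T ↔ ∀ G : M.Num → M.Num, DeltaFun G →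
    G 0 = 0 → (∀ n, ∃ k, G (n + 1) = snoc M (G n) k) → ∃ n, G n ∉ T := by
  constructor
  · intro h G hG h0 hs
    by_contra! hT
    refine h ⟨_, hG.mem, fun n => ⟨G n, by simp, fun y hy => by simpa using hy⟩, by simp [h0],
      fun n σ hσ => ?_, fun n σ hσ => ?_⟩
    · rw [DeltaFun.pair_mem_iff] at hσ
      subst hσ
      simpa [eq_comm] using hs n
    · rw [DeltaFun.pair_mem_iff] at hσ
      exact hσ ▸ hT n
  · rintro h ⟨g, hg, hfun, h0, hs, hT⟩
    choose G hG hG' using hfun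
    have hgraph : DeltaFun G := by
      refine ⟨?_⟩
      convert hg using 1
      ext z
      refine ⟨fun hz => ?_, fun hz => hG' _ _ (by simpa using hz)⟩
      have := hG (fst z)
      rw [← (show snd z = _ from hz)] at this
      simpa using this
    obtain ⟨n, hn⟩ := h G hgraph (hG' _ _ h0).symm fun n => by
      obtain ⟨k, hk⟩ := hs n _ (hG n)
      exact ⟨k, (hG' _ _ hk).symm⟩
    exact hn (hT n _ (hG n))

theorem isLeaf_or_isInterior {N : L2Structure.{u}} {T : Set N.Num} {σ : N.Num} (h : σ ∈ T) :
    IsLeaf N T σ ∨ IsInterior N T σ := by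
  by_cases h' : ∃ n, snoc N σ n ∈ T
  · exact Or.inr ⟨h, h'⟩
  · exact Or.inl ⟨h, not_exists.1 h'⟩

/-- Two evaluation maps that disagree at a node disagree at a child of that node, so that a
disagreement at the root would lead to an infinite path. -/
theorem IsEvaluation.root_mem_iff {leafLabel leafTrue : M.Num → Prop} {T L f f' : Set M.Num}
    (hT : T ∈ M.Sets) (hf : f ∈ M.Sets) (hf' : f' ∈ M.Sets) (h : IsLabeledTree M leafLabel T L)
    (he : IsEvaluation M leafTrue T L f) (he' : IsEvaluation M leafTrue T L f') :
    0 ∈ f ↔ 0 ∈ f' := by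
  have := Fact.mk hT
  have := Fact.mk hf
  have := Fact.mk hf'
  obtain ⟨htree, hwf, hlab, hint, -⟩ := h
  by_contra h0
  have step (σ : M.Num) : ∃ n, (σ ∈ T ∧ ¬ (σ ∈ f ↔ σ ∈ f')) →
      snoc M σ n ∈ T ∧ ¬ (snoc M σ n ∈ f ↔ snoc M σ n ∈ f') := by
    by_contra H
    have H (n : M.Num) := Classical.not_imp.1 (not_exists.1 H n)
    obtain ⟨hσ, hne⟩ := (H 0).1
    have H (n : M.Num) := not_and_not_right.1 (H n).2
    obtain ⟨y, hy, -⟩ := hlab.2 σ hσ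
    rcases isLeaf_or_isInterior hσ with hl | hi
    · exact hne (((he.2 σ y hy).1 hl).trans ((he'.2 σ y hy).1 hl).symm)
    · rcases hint σ y hy hi with hc | hc
      · refine hne (((he.2 σ y hy).2.1 hi hc).trans (Iff.trans ?_ ((he'.2 σ y hy).2.1 hi hc).symm))
        exact exists_congr fun n => and_congr_right (H n)
      · refine hne (((he.2 σ y hy).2.2 hi hc).trans (Iff.trans ?_ ((he'.2 σ y hy).2.2 hi hc).symm))
        exact forall_congr' fun n => imp_congr_right (H n)
  obtain ⟨k, hk, hk'⟩ := exists_search (fun σ n => (σ ∈ T ∧ ¬ (σ ∈ f ↔ σ ∈ f')) →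
      snoc M σ n ∈ T ∧ ¬ (snoc M σ n ∈ f ↔ snoc M σ n ∈ f')) step
  have hkc := DeltaFun.comp k
  obtain ⟨G, hG, hG0, hGs⟩ := exists_primitive_recursion (M := M) 0 (fun _ σ => snoc M σ (k σ))
  have hGc := DeltaFun.comp G
  obtain ⟨n, hn⟩ := isWellFounded_iff.1 hwf G hG hG0 fun n => ⟨_, hGs n⟩
  refine hn (delta_induction (fun n => G n ∈ T ∧ ¬ (G n ∈ f ↔ G n ∈ f')) ?_ (fun n ih => ?_) n).1
  · rw [hG0]
    exact ⟨htree.1, h0⟩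
  · rw [hGs]
    exact hk' _ ih

theorem clopenLabel_inj {c d : M.Num} : clopenLabel M c = clopenLabel M d ↔ c = d :=
  (add_left_inj (1 : M.Num)).trans (add_left_inj (1 : M.Num))

/-- De Morgan: an evaluation map for the complementary code, with the values `0` and `1` exchanged, is
one for the code. -/
theorem IsBorelEvaluation.diff {X T L L' f : Set M.Num} (hX : X ∈ M.Sets) (h : IsBorelCode M T L)
    (hL' : IsComplementLabelling M T L L') (hf : IsBorelEvaluation M X T L' f) :
    IsBorelEvaluation M X T L (T \ f) := by
  refine ⟨Set.sdiff_subset, fun σ y hy => ⟨fun hl => ?_, fun hi hc => ?_, fun hi hc => ?_⟩⟩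
  · obtain ⟨c, rfl⟩ := h.2.2.2.2 σ y hy hl
    obtain ⟨c', hc', hcompl⟩ := (hL'.2 σ _ hy).2.2 c rfl
    have := (hf.2 σ _ hc').1 hl
    rw [Set.mem_sdiff, and_iff_right hl.1, this]
    simp only [clopenLabel_inj, exists_eq_left', hcompl X hX, not_not]
  · have := (hf.2 σ _ ((hL'.2 σ y hy).1 hc)).2.2 hi rfl
    rw [Set.mem_sdiff, and_iff_right hi.1, this]
    push Not
    exact exists_congr fun n => ⟨fun h => ⟨h.1, h.1, h.2⟩, fun h => ⟨h.1, h.2.2⟩⟩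
  · have := (hf.2 σ _ ((hL'.2 σ y hy).2.1 hc)).2.1 hi rfl
    rw [Set.mem_sdiff, and_iff_right hi.1, this]
    push Not
    exact forall_congr' fun n => ⟨fun h h' => ⟨h', h h'⟩, fun h h' => (h h').2⟩

end Strings

section Join

variable {M : L2Structure.{u}} [hM : Fact (IsModelRCA0 M)]

/-! ### The Borel code that joins a sequence of formulas -/

/-- A formula has only the labels `∪`, `∩`, `true` and `false`. -/
theorem IsFormula.label_cases {N : L2Structure.{u}} {T L : Set N.Num} (h : IsFormula N T L)
    {σ y : N.Num} (hy : pair N σ y ∈ L) :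
    (IsInterior N T σ ∧ (y = cupLabel N ∨ y = capLabel N)) ∨
      (IsLeaf N T σ ∧ (y = trueLabel N ∨ y = falseLabel N)) :=
  (isLeaf_or_isInterior (h.2.2.1.1 σ y hy)).symm.imp (fun hi => ⟨hi, h.2.2.2.1 σ y hy hi⟩)
    fun hl => ⟨hl, h.2.2.2.2 σ y hy hl⟩

theorem cupLabel_ne_capLabel : cupLabel M ≠ capLabel M := zero_ne_one

theorem clopenLabel_ne_cupLabel (c : M.Num) : clopenLabel M c ≠ cupLabel M :=
  hM.out.succ_ne_zero _

theorem clopenLabel_ne_capLabel (c : M.Num) : clopenLabel M c ≠ capLabel M := fun h =>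
  hM.out.succ_ne_zero c (add_right_cancel (h.trans (zero_add (1 : M.Num)).symm))

theorem trueLabel_eq : trueLabel M = clopenLabel M 0 := by
  rw [trueLabel, clopenLabel, zero_add]

theorem falseLabel_eq {N : L2Structure.{u}} : falseLabel N = clopenLabel N 1 := rfl

theorem trueLabel_ne_falseLabel : trueLabel M ≠ falseLabel M := by
  rw [trueLabel_eq, falseLabel_eq, Ne, clopenLabel_inj]
  exact zero_ne_one

/-- The tree with the trees `sec M T i` above the nodes `⟨i⟩`. -/
def joinTree (T : Set M.Num) : Set M.Num :=
  {τ | τ = 0 ∨ ∃ i, i < τ + 1 ∧ ∃ σ, σ < τ + 1 ∧ τ = prepend i σ ∧ σ ∈ sec M T i}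

/-- The labelling of `joinTree T` that has the label `∪` at the root, and at the nodes of
`sec M T i` the labels given by `sec M L i`, translated by `lab i`. -/
def joinLabelling (lab : M.Num → M.Num → M.Num) (L : Set M.Num) : Set M.Num :=
  {w | (fst w = 0 ∧ snd w = cupLabel M) ∨ ∃ i, i < fst w + 1 ∧ ∃ σ, σ < fst w + 1 ∧
    fst w = prepend i σ ∧ ∃ y, y < falseLabel M + 1 ∧ pair M σ y ∈ sec M L i ∧ snd w = lab i y}

theorem joinTree_mem {T : Set M.Num} (hT : T ∈ M.Sets) : joinTree T ∈ M.Sets := by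
  have := Fact.mk hT
  have h : DeltaPred fun τ : M.Num => τ = 0 ∨ ∃ i, i < τ + 1 ∧ ∃ σ, σ < τ + 1 ∧
    τ = prepend i σ ∧ pair M i σ ∈ T := inferInstance
  exact h.mem

theorem joinLabelling_mem {lab : M.Num → M.Num → M.Num} {L : Set M.Num} (hL : L ∈ M.Sets)
    (hlab : DeltaFun fun w => lab (fst w) (snd w)) : joinLabelling lab L ∈ M.Sets := by
  have := Fact.mk hL
  have := DeltaFun.comp₂ lab
  have h : DeltaPred fun w : M.Num => (fst w = 0 ∧ snd w = cupLabel M) ∨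
    ∃ i, i < fst w + 1 ∧ ∃ σ, σ < fst w + 1 ∧ fst w = prepend i σ ∧
      ∃ y, y < falseLabel M + 1 ∧ pair M i (pair M σ y) ∈ L ∧ snd w = lab i y := inferInstance
  exact h.mem

theorem zero_mem_joinTree (T : Set M.Num) : 0 ∈ joinTree T := Or.inl rfl

theorem prepend_mem_joinTree {T : Set M.Num} {i σ : M.Num} :
    prepend i σ ∈ joinTree T ↔ σ ∈ sec M T i := by
  constructor
  · rintro (h | ⟨j, -, τ, -, h, hτ⟩)
    · exact (prepend_ne_zero _ _ h).elim
    · obtain ⟨rfl, rfl⟩ := prepend_inj.1 h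
      exact hτ
  · exact fun h => Or.inr ⟨i, num_lt_add_one_iff.2 (le_prepend i σ).1, σ,
      num_lt_add_one_iff.2 (le_prepend i σ).2, rfl, h⟩

theorem joinTree_cases {T : Set M.Num} {τ : M.Num} (h : τ ∈ joinTree T) :
    τ = 0 ∨ ∃ i σ, τ = prepend i σ ∧ σ ∈ sec M T i :=
  h.imp_right fun ⟨i, _, σ, _, h⟩ => ⟨i, σ, h⟩

theorem snoc_prepend_mem_joinTree {T : Set M.Num} {i σ n : M.Num} :
    snoc M (prepend i σ) n ∈ joinTree T ↔ snoc M σ n ∈ sec M T i := by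
  rw [← prepend_snoc, prepend_mem_joinTree]

theorem isLeaf_joinTree_iff {T : Set M.Num} {i σ : M.Num} :
    IsLeaf M (joinTree T) (prepend i σ) ↔ IsLeaf M (sec M T i) σ := by
  simp only [IsLeaf, prepend_mem_joinTree, snoc_prepend_mem_joinTree]

theorem isInterior_joinTree_iff {T : Set M.Num} {i σ : M.Num} :
    IsInterior M (joinTree T) (prepend i σ) ↔ IsInterior M (sec M T i) σ := by
  simp only [IsInterior, prepend_mem_joinTree, snoc_prepend_mem_joinTree]

theorem snoc_mem_joinTree_cases {T : Set M.Num} {τ n : M.Num} (h : snoc M τ n ∈ joinTree T) :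
    (τ = 0 ∧ 0 ∈ sec M T n) ∨ ∃ i σ, τ = prepend i σ ∧ snoc M σ n ∈ sec M T i := by
  obtain h | ⟨i, σ, h, hσ⟩ := joinTree_cases h
  · exact (snoc_ne_zero _ _ h).elim
  · rcases string_cases σ with rfl | ⟨ρ, k, rfl⟩
    · rw [prepend_zero, snoc_inj] at h
      obtain ⟨rfl, rfl⟩ := h
      exact Or.inl ⟨rfl, hσ⟩
    · rw [prepend_snoc, snoc_inj] at h
      obtain ⟨rfl, rfl⟩ := h
      exact Or.inr ⟨i, ρ, rfl, hσ⟩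

theorem isTree_joinTree {T : Set M.Num} (h : ∀ i, IsTree M (sec M T i)) :
    IsTree M (joinTree T) := by
  refine ⟨zero_mem_joinTree T, fun τ n hτ => ?_⟩
  obtain ⟨rfl, -⟩ | ⟨i, σ, rfl, hσ⟩ := snoc_mem_joinTree_cases hτ
  exacts [zero_mem_joinTree T, prepend_mem_joinTree.2 ((h i).2 σ n hσ)]

/-- A path through the joined tree is a path through one of the trees. -/
theorem isWellFounded_joinTree {T : Set M.Num} (hT : T ∈ M.Sets)
    (h : ∀ i, IsWellFounded M (sec M T i)) : IsWellFounded M (joinTree T) := by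
  have := Fact.mk hT
  rw [isWellFounded_iff]
  intro G hG hG0 hGs
  by_contra! hmem
  have hGc := DeltaFun.comp G
  obtain ⟨i, hi⟩ := hGs 0
  rw [hG0, ← prepend_zero] at hi
  have key (n : M.Num) : ∃ σ, σ < G (n + 1) + 1 ∧ G (n + 1) = prepend i σ := by
    refine delta_induction (fun n => ∃ σ, σ < G (n + 1) + 1 ∧ G (n + 1) = prepend i σ)
      ⟨0, num_lt_add_one_iff.2 zero_le, hi⟩ (fun n ⟨σ, _, hσ⟩ => ?_) n
    obtain ⟨k, hk⟩ := hGs (n + 1)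
    rw [hσ, ← prepend_snoc] at hk
    exact ⟨_, num_lt_add_one_iff.2 (hk ▸ (le_prepend _ _).2), hk⟩
  obtain ⟨s, hs, hs'⟩ := exists_search (fun n σ => σ < G (n + 1) + 1 ∧ G (n + 1) = prepend i σ) key
  obtain ⟨n, hn⟩ := isWellFounded_iff.1 (h i) s hs
    (by simpa [prepend_inj] using ((hs' 0).2.symm.trans hi)) fun n => by
      obtain ⟨k, hk⟩ := hGs (n + 1)
      rw [(hs' (n + 1)).2, (hs' n).2, ← prepend_snoc, prepend_inj] at hk
      exact ⟨k, hk.2⟩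
  exact hn (prepend_mem_joinTree.1 ((hs' n).2 ▸ hmem (n + 1)))

theorem zero_pair_mem_joinLabelling {lab : M.Num → M.Num → M.Num} {L : Set M.Num} {z : M.Num} :
    pair M 0 z ∈ joinLabelling lab L ↔ z = cupLabel M := by
  constructor
  · rintro (⟨-, h⟩ | ⟨i, -, σ, -, h, -⟩)
    · simpa using h
    · exact (prepend_ne_zero i σ (by simpa using h.symm)).elim
  · exact fun h => Or.inl (by simpa using h)

theorem prepend_pair_mem_joinLabelling {lab : M.Num → M.Num → M.Num} {T L : Set M.Num}
    {i σ z : M.Num} (h : IsFormula M (sec M T i) (sec M L i)) :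
    pair M (prepend i σ) z ∈ joinLabelling lab L ↔ ∃ y, pair M σ y ∈ sec M L i ∧ z = lab i y := by
  constructor
  · rintro (⟨h, -⟩ | ⟨j, -, τ, -, hτ, y, -, hy, hz⟩)
    · exact (prepend_ne_zero i σ (by simpa using h)).elim
    · rw [fst_pair, prepend_inj] at hτ
      obtain ⟨rfl, rfl⟩ := hτ
      exact ⟨y, hy, by simpa using hz⟩
  · rintro ⟨y, hy, rfl⟩
    refine Or.inr ⟨i, ?_, σ, ?_, by simp, y, ?_, hy, by simp⟩
    · simpa [num_lt_add_one_iff] using (le_prepend i σ).1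
    · simpa [num_lt_add_one_iff] using (le_prepend i σ).2
    · rw [num_lt_add_one_iff]
      rcases h.label_cases hy with ⟨-, rfl | rfl⟩ | ⟨-, rfl | rfl⟩
      exacts [zero_le, le_add_self, (num_lt_add_one _).le, le_rfl]

theorem pair_mem_joinLabelling_cases {lab : M.Num → M.Num → M.Num} {L : Set M.Num} {τ z : M.Num}
    (hz : pair M τ z ∈ joinLabelling lab L) : (τ = 0 ∧ z = cupLabel M) ∨
      ∃ i σ y, τ = prepend i σ ∧ z = lab i y ∧ pair M σ y ∈ sec M L i := by
  rcases hz with hz | ⟨i, -, σ, -, hτ, y, -, hy, hz⟩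
  · exact Or.inl (by simpa using hz)
  · exact Or.inr ⟨i, σ, y, by simpa using hτ, by simpa using hz, hy⟩

/-- The translation `lab` of labels keeps `∪` and `∩`. In the formula with index `i` it takes `true`
to a code of the basic clopen set given by the binary string `m i`, and `false` to a code of the
empty set. -/
structure IsLeafTranslation (m : M.Num → M.Num) (lab : M.Num → M.Num → M.Num) : Prop where
  cup : ∀ i, lab i (cupLabel M) = cupLabel M
  cap : ∀ i, lab i (capLabel M) = capLabel M
  clopen_true : ∀ i, ∃ c, lab i (trueLabel M) = clopenLabel M c ∧
    ∀ X, InClopen M c X ↔ Prefix M (m i) X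
  clopen_false : ∀ i, ∃ c, lab i (falseLabel M) = clopenLabel M c ∧ ∀ X, ¬ InClopen M c X

/-- The label of a leaf labelled `true` is found by a search for a code of the set `{m i}`. -/
theorem exists_isLeafTranslation (m : M.Num → M.Num) [DeltaFun m] :
    ∃ lab : M.Num → M.Num → M.Num, DeltaFun (fun w => lab (fst w) (snd w)) ∧
      IsLeafTranslation m lab := by
  classical
  obtain ⟨s, hs, hs'⟩ := exists_search (fun p c : M.Num => InFinite M c p ∧
    ∀ i, i < fst (fst c) → InFinite M c i → i = p) fun p => by
      obtain ⟨c, hc⟩ := exists_finite_code (fun i => i = p) (p + 1)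
      exact ⟨c, (hc p).2 ⟨num_lt_add_one p, rfl⟩, fun i _ hi => ((hc i).1 hi).2⟩
  obtain ⟨e, he⟩ := exists_finite_code (fun i : M.Num => i = 0) 0
  have hsc := DeltaFun.comp s
  have hmc := DeltaFun.comp m
  have hcl (f : M.Num → M.Num) [DeltaFun f] : DeltaFun fun z => clopenLabel M (f z) :=
    inferInstanceAs (DeltaFun fun z => f z + 1 + 1)
  refine ⟨fun i y => if y = trueLabel M then clopenLabel M (s (m i)) else
    if y = falseLabel M then clopenLabel M e else y, inferInstance, fun i => ?_, fun i => ?_,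
    fun i => ⟨s (m i), if_pos rfl, fun X => ?_⟩, fun i => ⟨e, ?_, fun X => ?_⟩⟩
  · have h₁ := (clopenLabel_ne_cupLabel (0 : M.Num)).symm
    have h₂ := (clopenLabel_ne_cupLabel (1 : M.Num)).symm
    simp [trueLabel_eq, falseLabel_eq, h₁, h₂]
  · have h₁ := (clopenLabel_ne_capLabel (0 : M.Num)).symm
    have h₂ := (clopenLabel_ne_capLabel (1 : M.Num)).symm
    simp [trueLabel_eq, falseLabel_eq, h₁, h₂]
  · constructor
    · rintro ⟨p, hp, hpX⟩
      rwa [(hs' (m i)).2 p (inFinite_iff.1 hp).1 hp] at hpX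
    · exact fun h => ⟨m i, (hs' (m i)).1, h⟩
  · rw [if_neg trueLabel_ne_falseLabel.symm, if_pos rfl]
  · rintro ⟨p, hp, -⟩
    exact not_lt_zero ((he p).1 hp).1

theorem isInterior_zero_joinTree {T : Set M.Num} (h : ∀ i, IsTree M (sec M T i)) :
    IsInterior M (joinTree T) 0 :=
  ⟨zero_mem_joinTree T, 0, by rw [← prepend_zero, prepend_mem_joinTree]; exact (h 0).1⟩

theorem isBorelCode_join {m : M.Num → M.Num} {lab : M.Num → M.Num → M.Num} {T L : Set M.Num}
    (hT : T ∈ M.Sets) (h : ∀ i, IsFormula M (sec M T i) (sec M L i))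
    (hlab : IsLeafTranslation m lab) : IsBorelCode M (joinTree T) (joinLabelling lab L) := by
  refine ⟨isTree_joinTree fun i => (h i).1, isWellFounded_joinTree hT fun i => (h i).2.1,
    ⟨fun τ z hz => ?_, fun τ hτ => ?_⟩, fun τ z hz hi => ?_, fun τ z hz hl => ?_⟩
  · obtain ⟨rfl, -⟩ | ⟨i, σ, y, rfl, -, hy⟩ := pair_mem_joinLabelling_cases hz
    · exact zero_mem_joinTree T
    · exact prepend_mem_joinTree.2 ((h i).2.2.1.1 σ y hy)
  · obtain rfl | ⟨i, σ, rfl, hσ⟩ := joinTree_cases hτ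
    · exact ⟨_, zero_pair_mem_joinLabelling.2 rfl, fun z hz => zero_pair_mem_joinLabelling.1 hz⟩
    · obtain ⟨y, hy, hy'⟩ := (h i).2.2.1.2 σ hσ
      refine ⟨lab i y, (prepend_pair_mem_joinLabelling (h i)).2 ⟨y, hy, rfl⟩, fun z hz => ?_⟩
      obtain ⟨y', hz', rfl⟩ := (prepend_pair_mem_joinLabelling (h i)).1 hz
      rw [hy' y' hz']
  · obtain ⟨-, rfl⟩ | ⟨i, σ, y, rfl, rfl, hy⟩ := pair_mem_joinLabelling_cases hz
    · exact Or.inl rfl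
    · rw [isInterior_joinTree_iff] at hi
      rcases (h i).2.2.2.1 σ y hy hi with rfl | rfl
      exacts [Or.inl (hlab.cup i), Or.inr (hlab.cap i)]
  · obtain ⟨rfl, -⟩ | ⟨i, σ, y, rfl, rfl, hy⟩ := pair_mem_joinLabelling_cases hz
    · obtain ⟨n, hn⟩ := (isInterior_zero_joinTree fun i => (h i).1).2
      exact (hl.2 n hn).elim
    · rw [isLeaf_joinTree_iff] at hl
      rcases (h i).2.2.2.2 σ y hy hl with rfl | rfl
      exacts [(hlab.clopen_true i).imp fun _ => And.left,
        (hlab.clopen_false i).imp fun _ => And.left]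

/-! ### Evaluation maps for the joined code -/

/-- The sets `{σ | E i σ}` of nodes of the trees that are joined, put together. The root is added if
one of them contains the root of its tree. -/
def joinNodes (E : M.Num → M.Num → Prop) : Set M.Num :=
  {τ | (τ = 0 ∧ ∃ i, E i 0) ∨ ∃ i, i < τ + 1 ∧ ∃ σ, σ < τ + 1 ∧ τ = prepend i σ ∧ E i σ}

theorem joinNodes_mem {E : M.Num → M.Num → Prop} (hE : DeltaPred fun w => E (fst w) (snd w)) :
    joinNodes E ∈ M.Sets := by
  have := DeltaPred.comp₂ E
  -- The unbounded quantifier in the clause for the root has a fixed truth value.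
  by_cases h : ∃ i, E i 0
  · have h' : DeltaPred fun τ : M.Num => τ = 0 ∨
      ∃ i, i < τ + 1 ∧ ∃ σ, σ < τ + 1 ∧ τ = prepend i σ ∧ E i σ := inferInstance
    simpa only [joinNodes, h, and_true] using h'.mem
  · have h' : DeltaPred fun τ : M.Num =>
      ∃ i, i < τ + 1 ∧ ∃ σ, σ < τ + 1 ∧ τ = prepend i σ ∧ E i σ := inferInstance
    simpa only [joinNodes, h, and_false, false_or] using h'.mem

theorem zero_mem_joinNodes {E : M.Num → M.Num → Prop} : 0 ∈ joinNodes E ↔ ∃ i, E i 0 := by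
  constructor
  · rintro (⟨-, h⟩ | ⟨i, -, σ, -, h, -⟩)
    exacts [h, (prepend_ne_zero i σ h.symm).elim]
  · exact fun h => Or.inl ⟨rfl, h⟩

theorem prepend_mem_joinNodes {E : M.Num → M.Num → Prop} {i σ : M.Num} :
    prepend i σ ∈ joinNodes E ↔ E i σ := by
  constructor
  · rintro (⟨h, -⟩ | ⟨j, -, τ, -, h, hτ⟩)
    · exact (prepend_ne_zero _ _ h).elim
    · obtain ⟨rfl, rfl⟩ := prepend_inj.1 h
      exact hτ
  · exact fun h => Or.inr ⟨i, num_lt_add_one_iff.2 (le_prepend i σ).1, σ,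
      num_lt_add_one_iff.2 (le_prepend i σ).2, rfl, h⟩

/-- Evaluation maps `{σ | E i σ}` on the trees that are joined are put together to an evaluation map
for `X`. The leaves labelled `true` in the formula of index `i` have the value `1` only if `X` is in
the clopen set given by `m i`. -/
theorem isBorelEvaluation_join {m : M.Num → M.Num} {lab : M.Num → M.Num → M.Num}
    {T L X : Set M.Num} (h : ∀ i, IsFormula M (sec M T i) (sec M L i))
    (hlab : IsLeafTranslation m lab) (E : M.Num → M.Num → Prop)
    (hE : ∀ i, IsEvaluation M (fun y => y = trueLabel M ∧ Prefix M (m i) X)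
      (sec M T i) (sec M L i) {σ | E i σ}) :
    IsBorelEvaluation M X (joinTree T) (joinLabelling lab L) (joinNodes E) := by
  refine ⟨?_, fun τ z hz => ?_⟩
  · rintro τ (⟨rfl, -⟩ | ⟨i, -, σ, -, rfl, hσ⟩)
    exacts [zero_mem_joinTree T, prepend_mem_joinTree.2 ((hE i).1 hσ)]
  obtain ⟨rfl, rfl⟩ | ⟨i, σ, y, rfl, rfl, hy⟩ := pair_mem_joinLabelling_cases hz
  · refine ⟨fun hl => ?_, fun _ _ => ?_, fun _ hc => (cupLabel_ne_capLabel hc).elim⟩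
    · obtain ⟨n, hn⟩ := (isInterior_zero_joinTree fun i => (h i).1).2
      exact (hl.2 n hn).elim
    · simp only [← prepend_zero, prepend_mem_joinTree, prepend_mem_joinNodes, zero_mem_joinNodes]
      exact exists_congr fun n => (and_iff_right (h n).1.1).symm
  · rw [isLeaf_joinTree_iff, isInterior_joinTree_iff]
    simp only [prepend_mem_joinNodes, ← prepend_snoc, prepend_mem_joinTree]
    have hey := (hE i).2 σ y hy
    rcases (h i).label_cases hy with ⟨hi, hc⟩ | ⟨hl, hc⟩
    · have hlaby : lab i y = y := by
        rcases hc with rfl | rfl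
        exacts [hlab.cup i, hlab.cap i]
      rw [hlaby]
      exact ⟨fun hl => (hl.2 _ hi.2.choose_spec).elim, hey.2.1, hey.2.2⟩
    · refine ⟨fun _ => (hey.1 hl).trans ?_, fun hi => (hl.2 _ hi.2.choose_spec).elim,
        fun hi => (hl.2 _ hi.2.choose_spec).elim⟩
      rcases hc with rfl | rfl
      · obtain ⟨c, hc, hcX⟩ := hlab.clopen_true i
        simp only [hc, clopenLabel_inj, exists_eq_left', hcX, true_and]
      · obtain ⟨c, hc, hcX⟩ := hlab.clopen_false i
        simp only [hc, clopenLabel_inj, exists_eq_left', hcX, iff_false]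
        exact fun h => trueLabel_ne_falseLabel h.1.symm

/-- If no leaf is true, then the map with the constant value `0` is an evaluation map, since
interior nodes have children. -/
theorem isEvaluation_empty {T L : Set M.Num} {leafTrue : M.Num → Prop} (h : ∀ y, ¬ leafTrue y) :
    IsEvaluation M leafTrue T L ∅ := by
  refine ⟨Set.empty_subset T, fun σ y hy => ⟨fun _ => ?_, fun _ _ => ?_, fun hi _ => ?_⟩⟩
  · simp [h]
  · simp
  · obtain ⟨n, hn⟩ := hi.2
    simpa using ⟨n, hn⟩

variable {m : M.Num → M.Num} {lab : M.Num → M.Num → M.Num} {T L : Set M.Num}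

/-- For `X` above the string of index `i`, an evaluation map is given by one for the formula of
index `i`, with the value `0` at the nodes of the other formulas. -/
theorem exists_isBorelEvaluation_above_marker (h : ∀ i, IsFormula M (sec M T i) (sec M L i))
    (hm : ∀ i j, ∀ X ∈ M.Sets, Prefix M (m i) X → Prefix M (m j) X → i = j)
    (hlab : IsLeafTranslation m lab) {X f : Set M.Num} (hX : X ∈ M.Sets) (hf : f ∈ M.Sets)
    {i : M.Num} (hi : Prefix M (m i) X) (he : IsFormulaEvaluation M (sec M T i) (sec M L i) f) :
    ∃ F ∈ M.Sets, IsBorelEvaluation M X (joinTree T) (joinLabelling lab L) F ∧ (0 ∈ F ↔ 0 ∈ f) := by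
  have := Fact.mk hf
  refine ⟨joinNodes fun j σ => j = i ∧ σ ∈ f, joinNodes_mem inferInstance,
    isBorelEvaluation_join h hlab _ fun j => ?_, by simp [zero_mem_joinNodes]⟩
  -- For `j ≠ i` no leaf of the formula of index `j` is true, as `X` is not above `m j`.
  by_cases hj : j = i
  · subst hj
    rw [IsFormulaEvaluation] at he
    simpa [hi] using he
  · have hjX : ¬ Prefix M (m j) X := fun hj' => hj (hm j i X hX hj' hi)
    simpa [hj] using isEvaluation_empty (by simp [hjX])

theorem isCompletelyDetermined_join (h : ∀ i, IsFormula M (sec M T i) (sec M L i))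
    (hdet : ∀ i, IsDeterminedFormula M (sec M T i) (sec M L i))
    (hm : ∀ i j, ∀ X ∈ M.Sets, Prefix M (m i) X → Prefix M (m j) X → i = j)
    (hlab : IsLeafTranslation m lab) :
    IsCompletelyDetermined M (joinTree T) (joinLabelling lab L) := by
  intro X hX
  by_cases hi : ∃ i, Prefix M (m i) X
  · obtain ⟨i, hi⟩ := hi
    obtain ⟨f, hf, he⟩ := hdet i
    obtain ⟨F, hF, hFe, -⟩ := exists_isBorelEvaluation_above_marker h hm hlab hX hf hi he
    exact ⟨F, hF, hFe⟩
  · rw [not_exists] at hi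
    refine ⟨joinNodes fun _ _ => (0 : M.Num) = 1, joinNodes_mem inferInstance,
      isBorelEvaluation_join h hlab _ fun j => ?_⟩
    simpa using isEvaluation_empty (by simp [hi])

/-! ### Reading off the true formulas from a Baire approximation -/

/-- One of two binary strings is an initial segment of the other. -/
def Compatible (p q : M.Num) : Prop := IsInitial p q ∨ IsInitial q p

instance DeltaPred.compatible_comp (f g : M.Num → M.Num) [DeltaFun f] [DeltaFun g] :
    DeltaPred fun z => Compatible (f z) (g z) :=
  inferInstanceAs (DeltaPred fun z => IsInitial (f z) (g z) ∨ IsInitial (g z) (f z))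

theorem Prefix.compatible {p q : M.Num} {X : Set M.Num} (hX : X ∈ M.Sets) (hp : Prefix M p X)
    (hq : Prefix M q X) : Compatible p q :=
  (le_total (binLength p) (binLength q)).imp (hp.isInitial hX hq) (hq.isInitial hX hp)

theorem exists_generic_of_compatible {D : Set M.Num} (hD : D ∈ M.Sets)
    (hdense : ∀ n, IsDenseIn M fun X => InOpen M (sec M D n) X) {p q : M.Num}
    (h : Compatible p q) :
    ∃ X ∈ M.Sets, Prefix M p X ∧ Prefix M q X ∧ ∀ n, InOpen M (sec M D n) X := by
  rcases h with h | h
  · obtain ⟨X, hX, hqX, hgen⟩ := exists_generic hD hdense q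
    exact ⟨X, hX, hqX.of_isInitial hX h, hqX, hgen⟩
  · obtain ⟨X, hX, hpX, hgen⟩ := exists_generic hD hdense p
    exact ⟨X, hX, hpX, hpX.of_isInitial hX h, hgen⟩

/-- A Baire approximation to the joined code decides each formula: a generic point above the string
of index `i` lies in `U` or in `V` according to whether the formula of index `i` is true. -/
theorem isTrueFormula_iff {U V D : Set M.Num} (hT : T ∈ M.Sets) (hD : D ∈ M.Sets)
    (h : ∀ i, IsFormula M (sec M T i) (sec M L i))
    (hdet : ∀ i, IsDeterminedFormula M (sec M T i) (sec M L i))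
    (hm : ∀ i j, ∀ X ∈ M.Sets, Prefix M (m i) X → Prefix M (m j) X → i = j)
    (hlab : IsLeafTranslation m lab)
    (hUVD : IsBaireApproximation M (joinTree T) (joinLabelling lab L) U V D) (i : M.Num) :
    (IsTrueFormula M (sec M T i) (sec M L i) ↔ ∃ q, q ∈ U ∧ Compatible (m i) q) ∧
      (IsTrueFormula M (sec M T i) (sec M L i) ↔ ∀ q, ¬ (q ∈ V ∧ Compatible (m i) q)) := by
  obtain ⟨⟨-, hUV, hdense⟩, happrox⟩ := hUVD
  have hJ := joinTree_mem hT
  have hcode := isBorelCode_join hT h hlab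
  have hU : (∃ q, q ∈ U ∧ Compatible (m i) q) → IsTrueFormula M (sec M T i) (sec M L i) := by
    rintro ⟨q, hq, hc⟩
    obtain ⟨X, hX, hiX, hqX, hgen⟩ := exists_generic_of_compatible hD hdense hc
    obtain ⟨F, hF, hFe, hF0⟩ := (happrox X hX hgen).1 ⟨q, hq, hqX⟩
    obtain ⟨f, hf, he⟩ := hdet i
    obtain ⟨F', hF', hFe', hF0'⟩ := exists_isBorelEvaluation_above_marker h hm hlab hX hf hiX he
    exact ⟨f, hf, he, hF0'.1 ((IsEvaluation.root_mem_iff hJ hF hF' hcode hFe hFe').1 hF0)⟩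
  have hV : IsTrueFormula M (sec M T i) (sec M L i) → ∀ q, ¬ (q ∈ V ∧ Compatible (m i) q) := by
    rintro ⟨f, hf, he, hf0⟩ q ⟨hq, hc⟩
    obtain ⟨X, hX, hiX, hqX, hgen⟩ := exists_generic_of_compatible hD hdense hc
    obtain ⟨L', hL', hcompl, F, hF, hFe, hF0⟩ := (happrox X hX hgen).2 ⟨q, hq, hqX⟩
    obtain ⟨F', hF', hFe', hF0'⟩ := exists_isBorelEvaluation_above_marker h hm hlab hX hf hiX he
    have := Fact.mk hJ
    have := Fact.mk hF
    have hdiff : DeltaPred fun τ => τ ∈ joinTree T ∧ τ ∉ F := inferInstance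
    exact ((IsEvaluation.root_mem_iff hJ hdiff.mem hF' hcode (hFe.diff hX hcode hcompl) hFe').2
      (hF0'.2 hf0)).2 hF0
  have hor : (∃ q, q ∈ U ∧ Compatible (m i) q) ∨ ∃ q, q ∈ V ∧ Compatible (m i) q := by
    obtain ⟨X, hX, hiX, hXUV⟩ := hUV (m i)
    exact hXUV.imp (fun ⟨q, hq, hqX⟩ => ⟨q, hq, hiX.compatible hX hqX⟩)
      fun ⟨q, hq, hqX⟩ => ⟨q, hq, hiX.compatible hX hqX⟩
  refine ⟨⟨fun ht => hor.resolve_right fun ⟨q, hq⟩ => hV ht q hq, hU⟩, hV, fun hq => ?_⟩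
  exact hU (hor.resolve_right fun ⟨q, hq'⟩ => hq q hq')

end Join

end ReverseMath

theorem mainTheorem6 (M : ReverseMath.L2Structure) (hRCA : ReverseMath.IsModelRCA0 M)
    (hCDPB : ReverseMath.SatisfiesCDPB M) : ReverseMath.SatisfiesLCA M := by
  intro T hT L hL h
  have := Fact.mk hRCA
  obtain ⟨m, _, hm⟩ := ReverseMath.exists_marker (M := M)
  obtain ⟨lab, hlab, htrans⟩ := ReverseMath.exists_isLeafTranslation m
  obtain ⟨U, hU, V, hV, D, hD, hUVD⟩ := hCDPB _ (ReverseMath.joinTree_mem hT) _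
    (ReverseMath.joinLabelling_mem hL hlab)
    (ReverseMath.isBorelCode_join hT (fun i => (h i).1) htrans)
    (ReverseMath.isCompletelyDetermined_join (fun i => (h i).1) (fun i => (h i).2) hm htrans)
  have key := ReverseMath.isTrueFormula_iff hT hD (fun i => (h i).1) (fun i => (h i).2) hm
    htrans hUVD
  have := Fact.mk hU
  have := Fact.mk hV
  have hmc := ReverseMath.DeltaFun.comp m
  exact (ReverseMath.DeltaPred.of_sigma_pi _ (fun i q => q ∈ U ∧ ReverseMath.Compatible (m i) q)
    (fun i q => ¬ (q ∈ V ∧ ReverseMath.Compatible (m i) q)) (fun i => (key i).1)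
    fun i => (key i).2).mem
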